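/- For a square complex (or real) matrix $A$ let $\|A\|_p = \big(\mathrm{Tr}\,(A^*A)^{p/2}\big)^{1/p}$ for $1\le p<\infty$, and let $\|A\|_\infty$ be the operator norm of $A$ with respect to the Euclidean norm. Let $X,Y,Z$ be complex $n\times n$ matrices such that the $2n\times 2n$ block matrix $$M=\begin{pmatrix} X & Y\\ Y^* & Z\end{pmatrix}$$ is positive semidefinite, and for $1\le p\le\infty$ define the $2\times 2$ matrix $$m=\begin{pmatrix} \|X\|_p & \|Y\|_p\\ \|Y\|_p & \|Z\|_p\end{pmatrix}.$$ Then the following inequalities hold: (a) for $1\le p\le 2$, $\|M\|_p\ge\|m\|_p$; (b) for $2\le p\le\infty$, $\|M\|_p\le\|m\|_p$. -/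

import Mathlib

open scoped ENNReal Matrix ComplexOrder

/-- The (Schatten) `p`-norm of a square matrix over `ℝ` or `ℂ`:
`‖A‖_p = (Tr (A* A)^(p/2))^(1/p)` for finite `p`, where the power `(A* A)^(p/2)` is taken in the
functional calculus of Hermitian matrices, and the operator norm of `A` on Euclidean space for
`p = ∞`. Only exponents `1 ≤ p ≤ ∞` are meaningful. -/
noncomputable def schattenNorm {𝕜 : Type*} [RCLike 𝕜] {ι : Type*} [Fintype ι] [DecidableEq ι]
    (p : ℝ≥0∞) (A : Matrix ι ι 𝕜) : ℝ :=
  if p = ∞ then ‖Matrix.toEuclideanCLM (n := ι) (𝕜 := 𝕜) A‖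
  else (RCLike.re (cfc (fun x : ℝ => x ^ (p.toReal / 2)) (Aᴴ * A)).trace) ^ (1 / p.toReal)

/-- The real symmetric `2 × 2` matrix obtained from a block matrix `[[X, Y], [Y*, Z]]` by replacing
each block by its `p`-norm. -/
noncomputable def blockNormMatrix {𝕜 : Type*} [RCLike 𝕜] {ι : Type*} [Fintype ι] [DecidableEq ι]
    (p : ℝ≥0∞) (X Y Z : Matrix ι ι 𝕜) : Matrix (Fin 2) (Fin 2) ℝ :=
  !![schattenNorm p X, schattenNorm p Y; schattenNorm p Y, schattenNorm p Z]

/-! ### Comparison of power sums through a logarithmic kernel -/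

section LogKernel

open MeasureTheory Set Filter Topology

/-! Case `1 ≤ p ≤ 2`. A singular value decomposition of `Y` and a block diagonal unitary conjugation
make `Y` diagonal with entries `y i ≥ 0`. Write `x i`, `z i` for the resulting diagonals of `X` and
`Z`. The quantity to control is the excess `Tr M^p - Tr X^p - Tr Z^p`, bounded below in two moves.

From matrices to scalars: the excess is at least the sum of the excesses of the `2 × 2` matrices
with rows `(x i, y i)` and `(y i, z i)`. For `1 < p < 2`, `t ^ p` is a positive mixture over `s` of
`t / s - log (1 + t / s)`, so families of equal size and equal sum are compared through the products
`∏ (a i + s)` (`sum_rpow_le_of_prod_add_le`). What is needed is thus a determinant inequality for `M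
+ s`, of Fischer type: `det M / (det X det Z)` is at most its value after pinching to the index
pairs `{i, i'}` (`det_fromBlocks_mul_prod_le`). It follows from `log det (E + tK)`, whose second
derivative is `-tr (A⁻¹KA⁻¹K)` at `A = E + tK`; this trace is convex in `A` and therefore decreases
under pinching.

From many scalars to one: the `2 × 2` excesses sum to at least the excess of `m`
(`eigPowSum_sub_le_sum`). By homogeneity and Jensen this reduces to joint convexity of `(X, Z) ↦
eigPowSum p (X^(1/p)) 1 (Z^(1/p))`, together with the fact that the excess decreases as the diagonal
grows, since `∑ x i ^ p ≤ Tr X^p`.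

Case `p ≥ 2`. Duality with the conjugate exponent `q ≤ 2`: for positive `N`, blockwise Hölder and
then Hölder for `2 × 2` matrices give `Tr (MN) ≤ ‖m‖_p ‖n‖_q`, where `n` is the matrix of block
`q`-norms of `N`, and the first case gives `‖n‖_q ≤ ‖N‖_q`. Take `N = M^(p-1)`, or an
eigenprojection when `p = ∞`. -/

theorem sub_log_one_add_nonneg {t : ℝ} (ht : 0 ≤ t) : 0 ≤ t - Real.log (1 + t) := by
  have := Real.log_le_sub_one_of_pos (x := 1 + t) (by linarith)
  linarith

theorem sub_log_one_add_le_sq {t : ℝ} (ht : 0 ≤ t) : t - Real.log (1 + t) ≤ t ^ 2 := by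
  have h := Real.one_sub_inv_le_log_of_pos (x := 1 + t) (by linarith)
  have h2 : t - (1 - (1 + t)⁻¹) ≤ t ^ 2 := by
    have : t - (1 - (1 + t)⁻¹) = t ^ 2 / (1 + t) := by field_simp; ring
    rw [this]
    exact div_le_self (by positivity) (by linarith)
  linarith

/-- The integrand representing `t ^ p`, for `1 < p < 2`, as a mixture of the functions
`t / s - log (1 + t / s)`. -/
noncomputable def logKernel (p t s : ℝ) : ℝ := (t / s - Real.log (1 + t / s)) * s ^ (p - 1)

theorem logKernel_nonneg (p : ℝ) {t s : ℝ} (ht : 0 ≤ t) (hs : 0 < s) : 0 ≤ logKernel p t s :=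
  mul_nonneg (sub_log_one_add_nonneg (by positivity)) (by positivity)

theorem continuousOn_logKernel (p : ℝ) {t : ℝ} (ht : 0 ≤ t) :
    ContinuousOn (logKernel p t) (Ioi 0) := by
  unfold logKernel
  have h0 : ∀ s ∈ Ioi (0 : ℝ), s ≠ 0 := fun s hs => ne_of_gt hs
  have h1 : ContinuousOn (fun s : ℝ => t / s) (Ioi 0) := continuousOn_const.div continuousOn_id h0
  refine ContinuousOn.mul (h1.sub ((continuousOn_const.add h1).log ?_)) ?_
  · intro s hs
    have : 0 < s := hs
    have : 0 < 1 + t / s := by positivity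
    exact this.ne'
  · exact continuousOn_id.rpow_const fun s hs => Or.inl (h0 s hs)

/-- The kernel is at most `s ^ (p - 2)` near `0` and `s ^ (p - 3)` near infinity, which is where `1
< p` and `p < 2` are needed. -/
theorem integrableOn_logKernel_one {p : ℝ} (h1 : 1 < p) (h2 : p < 2) :
    IntegrableOn (logKernel p 1) (Ioi 0) := by
  rw [← Ioc_union_Ioi_eq_Ioi (zero_le_one (α := ℝ))]
  refine IntegrableOn.union ?_ ?_
  · have hg : IntegrableOn (fun s : ℝ => s ^ (p - 2)) (Ioc 0 1) :=
      (intervalIntegrable_iff_integrableOn_Ioc_of_le zero_le_one).1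
        (intervalIntegral.intervalIntegrable_rpow' (by linarith))
    refine hg.mono' ((continuousOn_logKernel p zero_le_one).mono
      Ioc_subset_Ioi_self |>.aestronglyMeasurable measurableSet_Ioc) ?_
    refine (ae_restrict_iff' measurableSet_Ioc).2 (Eventually.of_forall fun s hs => ?_)
    rw [Real.norm_of_nonneg (logKernel_nonneg p zero_le_one hs.1)]
    have hl : 0 ≤ Real.log (1 + 1 / s) :=
      Real.log_nonneg (by have := hs.1; have : 0 ≤ 1 / s := by positivity
                          linarith)
    calc logKernel p 1 s ≤ (1 / s) * s ^ (p - 1) :=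
          mul_le_mul_of_nonneg_right (by linarith) (Real.rpow_nonneg hs.1.le _)
      _ = s ^ (p - 2) := by
          rw [show p - 2 = p - 1 - 1 by ring, Real.rpow_sub_one hs.1.ne' (p - 1)]; ring
  · have hg : IntegrableOn (fun s : ℝ => s ^ (p - 3)) (Ioi 1) :=
      integrableOn_Ioi_rpow_of_lt (by linarith) one_pos
    refine hg.mono' ((continuousOn_logKernel p zero_le_one).mono
      (Ioi_subset_Ioi zero_le_one) |>.aestronglyMeasurable measurableSet_Ioi) ?_
    refine (ae_restrict_iff' measurableSet_Ioi).2 (Eventually.of_forall fun s hs => ?_)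
    have hs0 : 0 < s := lt_trans one_pos hs
    rw [Real.norm_of_nonneg (logKernel_nonneg p zero_le_one hs0)]
    calc logKernel p 1 s ≤ (1 / s) ^ 2 * s ^ (p - 1) :=
          mul_le_mul_of_nonneg_right (sub_log_one_add_le_sq (by positivity))
            (Real.rpow_nonneg hs0.le _)
      _ = s ^ (p - 3) := by
          rw [show p - 3 = p - 1 - 1 - 1 by ring, Real.rpow_sub_one hs0.ne' (p - 1 - 1),
            Real.rpow_sub_one hs0.ne' (p - 1)]; ring

theorem logKernel_eq_mul {p t s : ℝ} (ht : 0 < t) (hs : 0 < s) :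
    logKernel p t s = t ^ (p - 1) * logKernel p 1 (t⁻¹ * s) := by
  unfold logKernel
  rw [Real.mul_rpow (by positivity) hs.le, Real.inv_rpow ht.le]
  have h : 1 / (t⁻¹ * s) = t / s := by field_simp
  have : t ^ (p - 1) ≠ 0 := (Real.rpow_pos_of_pos ht _).ne'
  rw [h]; field_simp

theorem integrableOn_logKernel {p t : ℝ} (h1 : 1 < p) (h2 : p < 2) (ht : 0 ≤ t) :
    IntegrableOn (logKernel p t) (Ioi 0) := by
  rcases ht.eq_or_lt with rfl | ht
  · have : logKernel p 0 = fun _ => 0 := by funext s; simp [logKernel]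
    rw [this]; exact integrableOn_zero
  · have h : IntegrableOn (fun s => t ^ (p - 1) * logKernel p 1 (t⁻¹ * s)) (Ioi 0) := by
      refine Integrable.const_mul ?_ _
      have := (integrableOn_Ioi_comp_mul_left_iff (logKernel p 1) 0 (inv_pos.2 ht)).2
        (by simpa using integrableOn_logKernel_one h1 h2)
      exact this
    exact h.congr_fun (fun s hs => (logKernel_eq_mul ht hs).symm) measurableSet_Ioi

theorem integral_logKernel {p t : ℝ} (h1 : 1 < p) (ht : 0 ≤ t) :
    ∫ s in Ioi 0, logKernel p t s = t ^ p * ∫ s in Ioi 0, logKernel p 1 s := by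
  rcases ht.eq_or_lt with rfl | ht
  · have : logKernel p 0 = fun _ => 0 := by funext s; simp [logKernel]
    rw [this, Real.zero_rpow (by linarith)]; simp
  · rw [setIntegral_congr_fun measurableSet_Ioi (fun s hs => logKernel_eq_mul ht hs),
      integral_const_mul, integral_comp_mul_left_Ioi (logKernel p 1) 0 (inv_pos.2 ht)]
    have : t ^ p = t ^ (p - 1) * t := by
      rw [Real.rpow_sub_one ht.ne']; field_simp
    simp [this, mul_assoc]

theorem integral_logKernel_one_pos {p : ℝ} (h1 : 1 < p) (h2 : p < 2) :
    0 < ∫ s in Ioi 0, logKernel p 1 s := by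
  rw [setIntegral_pos_iff_support_of_nonneg_ae
    ((ae_restrict_iff' measurableSet_Ioi).2 (Eventually.of_forall fun s hs =>
      logKernel_nonneg p zero_le_one hs)) (integrableOn_logKernel_one h1 h2)]
  have : Function.support (logKernel p 1) ∩ Ioi 0 = Ioi 0 := by
    refine inter_eq_right.2 fun s hs => ?_
    have hs : 0 < s := hs
    have := Real.log_lt_sub_one_of_pos (x := 1 + 1 / s) (by positivity)
      (by have : 0 < 1 / s := by positivity
          linarith)
    exact (mul_pos (by linarith) (Real.rpow_pos_of_pos hs _)).ne'
  rw [this]; simp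

/-- At each `s` the family enters only through its size, its sum and its shifted product. -/
theorem sum_logKernel_eq {ι : Type*} [Fintype ι] (p : ℝ) {a : ι → ℝ} (ha : ∀ i, 0 ≤ a i)
    {s : ℝ} (hs : 0 < s) :
    ∑ i, logKernel p (a i) s
      = ((∑ i, a i) / s + Fintype.card ι * Real.log s - Real.log (∏ i, (a i + s)))
          * s ^ (p - 1) := by
  have h : ∀ i, Real.log (1 + a i / s) = Real.log (a i + s) - Real.log s := fun i => by
    rw [← Real.log_div (by have := ha i; positivity) hs.ne']
    congr 1; field_simp; ring
  simp only [logKernel, ← Finset.sum_mul, h]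
  rw [Real.log_prod (fun i _ => by have := ha i; positivity)]
  simp only [Finset.sum_sub_distrib, Finset.sum_div, Finset.sum_const, Finset.card_univ,
    nsmul_eq_mul]
  ring

theorem sum_rpow_le_of_prod_add_le_of_lt {ι κ : Type*} [Fintype ι] [Fintype κ]
    {a : ι → ℝ} {b : κ → ℝ}
    (ha : ∀ i, 0 ≤ a i) (hb : ∀ j, 0 ≤ b j) (hcard : Fintype.card ι = Fintype.card κ)
    (hsum : ∑ i, a i = ∑ j, b j) (hprod : ∀ s, 0 < s → ∏ i, (a i + s) ≤ ∏ j, (b j + s))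
    {p : ℝ} (h1 : 1 < p) (h2 : p < 2) : ∑ j, b j ^ p ≤ ∑ i, a i ^ p := by
  refine le_of_mul_le_mul_right ?_ (integral_logKernel_one_pos h1 h2)
  simp only [Finset.sum_mul]
  simp only [← integral_logKernel h1 (ha _), ← integral_logKernel h1 (hb _)]
  rw [← integral_finsetSum _ (fun i _ => integrableOn_logKernel h1 h2 (ha i)),
    ← integral_finsetSum _ (fun i _ => integrableOn_logKernel h1 h2 (hb i))]
  refine setIntegral_mono_on
    (integrable_finsetSum _ (fun i _ => integrableOn_logKernel h1 h2 (hb i)))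
    (integrable_finsetSum _ (fun i _ => integrableOn_logKernel h1 h2 (ha i)))
    measurableSet_Ioi fun s hs => ?_
  have hs : 0 < s := hs
  rw [sum_logKernel_eq p ha hs, sum_logKernel_eq p hb hs, hsum, hcard]
  have := Real.log_le_log (Finset.prod_pos fun i _ => by have := ha i; positivity) (hprod s hs)
  exact mul_le_mul_of_nonneg_right (by linarith) (by positivity)

/-- Nonnegative families with the same sum, whose shifted products are comparable, have comparable
sums of `p`-th powers for `1 ≤ p ≤ 2`. -/
theorem sum_rpow_le_of_prod_add_le {ι κ : Type*} [Fintype ι] [Fintype κ]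
    {a : ι → ℝ} {b : κ → ℝ}
    (ha : ∀ i, 0 ≤ a i) (hb : ∀ j, 0 ≤ b j) (hcard : Fintype.card ι = Fintype.card κ)
    (hsum : ∑ i, a i = ∑ j, b j) (hprod : ∀ s, 0 < s → ∏ i, (a i + s) ≤ ∏ j, (b j + s))
    {p : ℝ} (h1 : 1 ≤ p) (h2 : p ≤ 2) : ∑ j, b j ^ p ≤ ∑ i, a i ^ p := by
  rcases h1.eq_or_lt with rfl | h1
  · simp [hsum]
  rcases h2.lt_or_eq with h2 | rfl
  · exact sum_rpow_le_of_prod_add_le_of_lt ha hb hcard hsum hprod h1 h2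
  -- The kernel is not integrable at infinity for `p = 2`, so this endpoint is a limit from below.
  · have hc : ∀ {μ : Type _} [Fintype μ] (c : μ → ℝ),
        Tendsto (fun r : ℝ => ∑ i, c i ^ r) (𝓝[<] 2) (𝓝 (∑ i, c i ^ (2 : ℝ))) :=
      fun c => tendsto_finsetSum _ fun i _ =>
        ((Real.continuousAt_const_rpow' two_ne_zero).tendsto).mono_left nhdsWithin_le_nhds
    have hc' : ∀ {μ : Type _} [Fintype μ] (c : μ → ℝ),
        Tendsto (fun r : ℝ => ∑ i, c i ^ r) (𝓝[<] 2) (𝓝 (∑ i, c i ^ (2 : ℝ))) :=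
      fun c => tendsto_finsetSum _ fun i _ =>
        ((Real.continuousAt_const_rpow' two_ne_zero).tendsto).mono_left nhdsWithin_le_nhds
    refine le_of_tendsto_of_tendsto (hc b) (hc' a) ?_
    filter_upwards [Ioo_mem_nhdsLT (show (1 : ℝ) < 2 by norm_num)] with r hr
    exact sum_rpow_le_of_prod_add_le_of_lt ha hb hcard hsum hprod hr.1 hr.2

end LogKernel

/-! ### Scalar inequalities and eigenvalues of `2 × 2` matrices -/

section TwoByTwo

open MeasureTheory Set Filter Topology

theorem rpow_le_tangent {q l m : ℝ} (h0 : 0 ≤ q) (h1 : q ≤ 1) (hl : 0 < l) (hm : 0 < m) :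
    m ^ q ≤ (1 - q) * l ^ q + q * m * l ^ (q - 1) := by
  have h := rpow_one_add_le_one_add_mul_self (s := m / l - 1) (p := q)
    (by have : 0 < m / l := by positivity
        linarith) h0 h1
  rw [add_sub_cancel, Real.div_rpow hm.le hl.le, div_le_iff₀ (by positivity)] at h
  rw [Real.rpow_sub_one hl.ne']
  calc m ^ q ≤ _ := h
    _ = _ := by field_simp; ring

theorem tangent_le_rpow_sub_one {q l m : ℝ} (h1 : q ≤ 1) (hl : 0 < l) (hm : 0 < m) :
    l ^ (q - 1) + (q - 1) * l ^ (q - 2) * (m - l) ≤ m ^ (q - 1) := by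
  have h : 1 + (q - 1) * (m / l - 1) ≤ (m / l) ^ (q - 1) := by
    have hml : 0 < m / l := by positivity
    rw [Real.rpow_def_of_pos hml]
    have h2 := Real.add_one_le_exp (Real.log (m / l) * (q - 1))
    have h3 := Real.log_le_sub_one_of_pos hml
    nlinarith
  rw [Real.div_rpow hm.le hl.le, le_div_iff₀ (by positivity)] at h
  rw [show q - 2 = q - 1 - 1 by ring, Real.rpow_sub_one hl.ne' (q - 1)]
  calc _ = (1 + (q - 1) * (m / l - 1)) * l ^ (q - 1) := by field_simp
    _ ≤ _ := h

/-- The trapezoid rule overestimates the integral of the convex function `u ^ (q - 1)`. The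
derivative in `l` of the gap is `q` times a tangent-line gap. -/
theorem rpow_sub_rpow_le_trapezoid {q l m : ℝ} (h0 : 0 ≤ q) (h1 : q ≤ 1) (hm : 0 < m)
    (hml : m ≤ l) :
    2 * (l ^ q - m ^ q) ≤ q * (l ^ (q - 1) + m ^ (q - 1)) * (l - m) := by
  have hd : ∀ u ∈ Ici m, HasDerivAt
      (fun u => q * (u ^ (q - 1) + m ^ (q - 1)) * (u - m) - 2 * (u ^ q - m ^ q))
      (q * (1 * (q - 1) * u ^ (q - 1 - 1)) * (u - m) + q * (u ^ (q - 1) + m ^ (q - 1)) * 1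
        - 2 * (1 * q * u ^ (q - 1))) u := fun u hu => by
    have hu : 0 < u := hm.trans_le hu
    have e1 := (hasDerivAt_id u).rpow_const (p := q - 1) (Or.inl hu.ne')
    have e2 := (hasDerivAt_id u).rpow_const (p := q) (Or.inl hu.ne')
    exact ((((e1.add_const (m ^ (q - 1))).const_mul q).mul
      ((hasDerivAt_id u).sub_const m))).sub ((e2.sub_const (m ^ q)).const_mul 2)
  have hmono := monotoneOn_of_hasDerivWithinAt_nonneg (convex_Ici m)
    (fun u hu => (hd u hu).continuousAt.continuousWithinAt)
    (fun u hu => (hd u (interior_subset hu)).hasDerivWithinAt) (fun u hu => by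
      have hu : 0 < u := hm.trans_le (interior_subset hu)
      have := mul_nonneg h0 (sub_nonneg.2 (tangent_le_rpow_sub_one h1 hu hm))
      rw [show q - 1 - 1 = q - 2 by ring]
      linarith)
  have := hmono self_mem_Ici (show l ∈ Ici m from hml) hml
  simp only [sub_self, mul_zero] at this
  linarith

/-- The scalar inequality behind Hanner's inequality. -/
theorem mul_rpow_add_rpow_le {q l m : ℝ} (h0 : 0 ≤ q) (h1 : q ≤ 1) (hm : 0 < m)
    (hml : m ≤ l) :
    q * (l - m) * (l ^ q + m ^ q) ≤ (l + m) * (l ^ q - m ^ q) := by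
  -- The gap vanishes at `u = m`, and its derivative is `1 + q` times the gap in `rpow_le_tangent`.
  have hd : ∀ u ∈ Ici m, HasDerivAt
      (fun u => (u + m) * (u ^ q - m ^ q) - q * (u - m) * (u ^ q + m ^ q))
      ((1 * (u ^ q - m ^ q) + (u + m) * (1 * q * u ^ (q - 1)))
        - (q * 1 * (u ^ q + m ^ q) + q * (u - m) * (1 * q * u ^ (q - 1)))) u := fun u hu => by
    have hu : 0 < u := hm.trans_le hu
    have e2 := (hasDerivAt_id u).rpow_const (p := q) (Or.inl hu.ne')
    exact (((hasDerivAt_id u).add_const m).mul (e2.sub_const (m ^ q))).sub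
      ((((hasDerivAt_id u).sub_const m).const_mul q).mul (e2.add_const (m ^ q)))
  have hmono := monotoneOn_of_hasDerivWithinAt_nonneg (convex_Ici m)
    (fun u hu => (hd u hu).continuousAt.continuousWithinAt)
    (fun u hu => (hd u (interior_subset hu)).hasDerivWithinAt) (fun u hu => by
      have hu : 0 < u := hm.trans_le (interior_subset hu)
      have := mul_nonneg (show 0 ≤ 1 + q by linarith)
        (sub_nonneg.2 (rpow_le_tangent h0 h1 hu hm))
      have e : u ^ q = u * u ^ (q - 1) := by rw [Real.rpow_sub_one hu.ne']; field_simp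
      rw [e] at this ⊢
      linarith)
  have := hmono self_mem_Ici (show l ∈ Ici m from hml) hml
  simp only [sub_self, mul_zero, zero_mul] at this
  linarith

/-- The larger eigenvalue of the symmetric matrix with rows `(x, y)` and `(y, z)`. -/
noncomputable def eigHi (x y z : ℝ) : ℝ := (x + z) / 2 + √(((x - z) / 2) ^ 2 + y ^ 2)

/-- The smaller eigenvalue of the symmetric matrix with rows `(x, y)` and `(y, z)`. -/
noncomputable def eigLo (x y z : ℝ) : ℝ := (x + z) / 2 - √(((x - z) / 2) ^ 2 + y ^ 2)

/-- The sum of the `p`-th powers of the eigenvalues of the symmetric matrix with rows `(x, y)` and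
`(y, z)`. -/
noncomputable def eigPowSum (p x y z : ℝ) : ℝ := eigHi x y z ^ p + eigLo x y z ^ p

theorem eigHi_add_eigLo (x y z : ℝ) : eigHi x y z + eigLo x y z = x + z := by
  unfold eigHi eigLo; ring

theorem eigHi_add_mul_eigLo_add (x y z s : ℝ) :
    (eigHi x y z + s) * (eigLo x y z + s) = (x + s) * (z + s) - y ^ 2 := by
  have h : √(((x - z) / 2) ^ 2 + y ^ 2) ^ 2 = ((x - z) / 2) ^ 2 + y ^ 2 :=
    Real.sq_sqrt (by positivity)
  unfold eigHi eigLo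
  linear_combination -h

theorem eigHi_nonneg {x z : ℝ} (y : ℝ) (hx : 0 ≤ x) (hz : 0 ≤ z) : 0 ≤ eigHi x y z := by
  unfold eigHi; positivity

theorem eigLo_nonneg {x y z : ℝ} (hx : 0 ≤ x) (hz : 0 ≤ z) (h : y ^ 2 ≤ x * z) :
    0 ≤ eigLo x y z := by
  unfold eigLo
  rw [sub_nonneg]
  exact Real.sqrt_le_iff.2 ⟨by positivity, by nlinarith⟩

theorem eigPowSum_nonneg {x y z : ℝ} (p : ℝ) (hx : 0 ≤ x) (hz : 0 ≤ z) (h : y ^ 2 ≤ x * z) :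
    0 ≤ eigPowSum p x y z :=
  add_nonneg (Real.rpow_nonneg (eigHi_nonneg y hx hz) _)
    (Real.rpow_nonneg (eigLo_nonneg hx hz h) _)

theorem eigPowSum_zero (p x z : ℝ) : eigPowSum p x 0 z = x ^ p + z ^ p := by
  have : √(((x - z) / 2) ^ 2 + 0 ^ 2) = |(x - z) / 2| := by
    rw [zero_pow two_ne_zero, add_zero, Real.sqrt_sq_eq_abs]
  unfold eigPowSum eigHi eigLo
  rw [this]
  rcases abs_choice ((x - z) / 2) with h | h <;> rw [h]
  · rw [show (x + z) / 2 + (x - z) / 2 = x by ring, show (x + z) / 2 - (x - z) / 2 = z by ring]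
  · rw [show (x + z) / 2 + -((x - z) / 2) = z by ring,
      show (x + z) / 2 - -((x - z) / 2) = x by ring, add_comm]

theorem eigPowSum_comm (p x y z : ℝ) : eigPowSum p z y x = eigPowSum p x y z := by
  unfold eigPowSum eigHi eigLo
  rw [show ((z - x) / 2) ^ 2 = ((x - z) / 2) ^ 2 by ring, add_comm z x]

theorem eigPowSum_mul {c x y z : ℝ} (p : ℝ) (hc : 0 ≤ c) (hx : 0 ≤ x) (hz : 0 ≤ z)
    (h : y ^ 2 ≤ x * z) :
    eigPowSum p (c * x) (c * y) (c * z) = c ^ p * eigPowSum p x y z := by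
  have hs : √(((c * x - c * z) / 2) ^ 2 + (c * y) ^ 2) = c * √(((x - z) / 2) ^ 2 + y ^ 2) := by
    rw [show ((c * x - c * z) / 2) ^ 2 + (c * y) ^ 2 = c ^ 2 * (((x - z) / 2) ^ 2 + y ^ 2) by ring,
      Real.sqrt_mul (by positivity), Real.sqrt_sq hc]
  have h1 : eigHi (c * x) (c * y) (c * z) = c * eigHi x y z := by
    unfold eigHi; rw [hs]; ring
  have h2 : eigLo (c * x) (c * y) (c * z) = c * eigLo x y z := by
    unfold eigLo; rw [hs]; ring
  unfold eigPowSum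
  rw [h1, h2, Real.mul_rpow hc (eigHi_nonneg y hx hz), Real.mul_rpow hc (eigLo_nonneg hx hz h)]
  ring

/-- Moving `x ^ p` and `x' ^ p` across turns this into a comparison of two families of three numbers
with the same sum; their shifted products differ by `y ^ 2 * (x' - x)`. -/
theorem eigPowSum_sub_antitone_left {p x x' y z : ℝ} (h1 : 1 ≤ p) (h2 : p ≤ 2) (hx : 0 ≤ x)
    (hxx : x ≤ x') (hz : 0 ≤ z) (h : y ^ 2 ≤ x * z) :
    eigPowSum p x' y z - x' ^ p ≤ eigPowSum p x y z - x ^ p := by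
  have hx' := hx.trans hxx
  have h' : y ^ 2 ≤ x' * z := h.trans (mul_le_mul_of_nonneg_right hxx hz)
  have key := sum_rpow_le_of_prod_add_le (a := ![eigHi x y z, eigLo x y z, x'])
    (b := ![eigHi x' y z, eigLo x' y z, x]) (p := p)
    (by intro i; fin_cases i
        exacts [eigHi_nonneg y hx hz, eigLo_nonneg hx hz h, hx'])
    (by intro i; fin_cases i
        exacts [eigHi_nonneg y hx' hz, eigLo_nonneg hx' hz h', hx])
    rfl (by
      simp only [Fin.sum_univ_three, Matrix.cons_val_zero, Matrix.cons_val_one, Matrix.cons_val]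
      rw [eigHi_add_eigLo, eigHi_add_eigLo]; ring)
    (fun s hs => by
      simp only [Fin.prod_univ_three, Matrix.cons_val_zero, Matrix.cons_val_one, Matrix.cons_val]
      rw [eigHi_add_mul_eigLo_add, eigHi_add_mul_eigLo_add]
      nlinarith [mul_nonneg (sq_nonneg y) (sub_nonneg.2 hxx)]) h1 h2
  simp only [Fin.sum_univ_three, Matrix.cons_val_zero, Matrix.cons_val_one, Matrix.cons_val] at key
  unfold eigPowSum
  linarith

theorem eigPowSum_sub_antitone {p x x' y z z' : ℝ} (h1 : 1 ≤ p) (h2 : p ≤ 2) (hx : 0 ≤ x)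
    (hxx : x ≤ x') (hz : 0 ≤ z) (hzz : z ≤ z') (h : y ^ 2 ≤ x * z) :
    eigPowSum p x' y z' - x' ^ p - z' ^ p ≤ eigPowSum p x y z - x ^ p - z ^ p := by
  have e1 := eigPowSum_sub_antitone_left h1 h2 hx hxx hz h
  have e2 := eigPowSum_sub_antitone_left (z := x') (y := y) h1 h2 hz hzz (hx.trans hxx)
    (by rw [mul_comm]; exact h.trans (mul_le_mul_of_nonneg_right hxx hz))
  rw [eigPowSum_comm p x' y z', eigPowSum_comm p x' y z] at e2
  linarith

/-- The algebra behind convexity. With `q = p - 1`, `L` and `M` are the eigenvalues, `l = L ^ (q -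
1)`, `k = M ^ (q - 1)`, `ξ` and `ζ` are the logarithmic derivatives of the diagonal entries `A + D`
and `A - D`, and indices count derivatives. The expression is `1 / p` times the second derivative of
`L ^ p + M ^ p`. `hT` is the trapezoid inequality, `hH` the Hanner one. -/
theorem eigPowSum_second_deriv_nonneg {q A D B L M l k ξ ζ : ℝ} (hB : 0 < B) (hDB : D ^ 2 ≤ B ^ 2)
    (hx : 0 ≤ A + D) (hz : 0 ≤ A - D)
    (hL : L = A + B) (hM : M = A - B) (hT : 2 * (l * L - k * M) ≤ q * (l + k) * (L - M))
    (hH : q * (L - M) * (l * L + k * M) ≤ (L + M) * (l * L - k * M))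
    {A₁ A₂ D₁ D₂ B₁ B₂ : ℝ} (hA₁ : A₁ = ((A + D) * ξ + (A - D) * ζ) / 2)
    (hD₁ : D₁ = ((A + D) * ξ - (A - D) * ζ) / 2)
    (hA₂ : A₂ = -q * ((A + D) * ξ ^ 2 + (A - D) * ζ ^ 2) / 2)
    (hD₂ : D₂ = -q * ((A + D) * ξ ^ 2 - (A - D) * ζ ^ 2) / 2)
    (hB₁ : B₁ = D * D₁ / B) (hB₂ : B₂ = (D₁ ^ 2 + D * D₂ - B₁ ^ 2) / B) :
    0 ≤ q * l * (A₁ + B₁) ^ 2 + q * k * (A₁ - B₁) ^ 2 + l * L * (A₂ + B₂) + k * M * (A₂ - B₂) := by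
  -- The quadratic form in `ξ`, `ζ` splits into two nonnegative ones, with coefficients signed by
  -- `hH` and `hT` respectively.
  have e : q * l * (A₁ + B₁) ^ 2 + q * k * (A₁ - B₁) ^ 2 + l * L * (A₂ + B₂) + k * M * (A₂ - B₂)
      = (B ^ 2 - D ^ 2) / (4 * B ^ 3) *
        (2 * (A * (l * L - k * M) - q * B * (l * L + k * M))
            * ((A + D) * ξ ^ 2 + (A - D) * ζ ^ 2)
          + (A + D) * (A - D) * (q * (l + k) * B - (l * L - k * M)) * (ξ + ζ) ^ 2) := by
    subst hL hM hB₂ hB₁ hA₁ hA₂ hD₁ hD₂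
    field_simp
    ring
  rw [e]
  subst hL hM
  have p1 : 0 ≤ A * (l * (A + B) - k * (A - B)) - q * B * (l * (A + B) + k * (A - B)) := by
    linarith
  have p2 : 0 ≤ q * (l + k) * B - (l * (A + B) - k * (A - B)) := by linarith
  have p3 : 0 ≤ B ^ 2 - D ^ 2 := by linarith
  positivity

end TwoByTwo

/-! ### Joint convexity and superadditivity of the `2 × 2` power sum -/

section Jensen

open MeasureTheory Set Filter Topology

theorem eigHi_pos {x y z : ℝ} (hx : 0 < x) (hz : 0 < z) : 0 < eigHi x y z := by
  unfold eigHi; positivity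

theorem eigLo_pos {x y z : ℝ} (hx : 0 < x) (hz : 0 < z) (h : y ^ 2 < x * z) :
    0 < eigLo x y z := by
  unfold eigLo
  rw [sub_pos]
  exact (Real.sqrt_lt' (by positivity)).2 (by nlinarith)

/-- If `x` and `z` move along curves whose `p`-th powers are affine, then the sum of the `p`-th
powers of the eigenvalues of the symmetric matrix with rows `(x, 1)` and `(1, z)` has a nonnegative
second derivative. -/
theorem exists_hasDerivAt_eigPowSum {p : ℝ} (h1 : 1 ≤ p) (h2 : p ≤ 2) {x z ξ ζ : ℝ → ℝ} {s : Set ℝ}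
    (hx : ∀ t ∈ s, 0 < x t) (hz : ∀ t ∈ s, 0 < z t) (hxz : ∀ t ∈ s, 1 < x t * z t)
    (dx : ∀ t ∈ s, HasDerivAt x (x t * ξ t) t) (dz : ∀ t ∈ s, HasDerivAt z (z t * ζ t) t)
    -- If `x = X^(1/p)` with `X` affine then `ξ = X' / (p X)`, which satisfies this Riccati
    -- equation.
    (dξ : ∀ t ∈ s, HasDerivAt ξ (-p * ξ t ^ 2) t)
    (dζ : ∀ t ∈ s, HasDerivAt ζ (-p * ζ t ^ 2) t) :
    ∃ f' f'' : ℝ → ℝ,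
      (∀ t ∈ s, HasDerivAt (fun t => eigPowSum p (x t) 1 (z t)) (f' t) t) ∧
      (∀ t ∈ s, HasDerivAt f' (f'' t) t) ∧ ∀ t ∈ s, 0 ≤ f'' t := by
  set q := p - 1 with hq
  set A : ℝ → ℝ := fun t => (x t + z t) / 2 with hA
  set D : ℝ → ℝ := fun t => (x t - z t) / 2 with hD
  set B : ℝ → ℝ := fun t => √(D t ^ 2 + 1 ^ 2) with hB
  set A₁ : ℝ → ℝ := fun t => (x t * ξ t + z t * ζ t) / 2 with hA₁
  set D₁ : ℝ → ℝ := fun t => (x t * ξ t - z t * ζ t) / 2 with hD₁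
  set B₁ : ℝ → ℝ := fun t => D t * D₁ t / B t with hB₁
  set A₂ : ℝ → ℝ := fun t => -q * (x t * ξ t ^ 2 + z t * ζ t ^ 2) / 2 with hA₂
  set D₂ : ℝ → ℝ := fun t => -q * (x t * ξ t ^ 2 - z t * ζ t ^ 2) / 2 with hD₂
  set B₂ : ℝ → ℝ := fun t => (D₁ t ^ 2 + D t * D₂ t - B₁ t ^ 2) / B t with hB₂
  have hBpos : ∀ t, 0 < B t := fun t => Real.sqrt_pos.2 (by positivity)
  have hBsq : ∀ t, B t ^ 2 = D t ^ 2 + 1 := fun t => by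
    rw [hB]; simp only; rw [Real.sq_sqrt (by positivity)]; ring
  have dA : ∀ t ∈ s, HasDerivAt A (A₁ t) t := fun t ht =>
    ((dx t ht).add (dz t ht)).div_const 2
  have dD : ∀ t ∈ s, HasDerivAt D (D₁ t) t := fun t ht =>
    ((dx t ht).sub (dz t ht)).div_const 2
  have dB : ∀ t ∈ s, HasDerivAt B (B₁ t) t := fun t ht => by
    have := (((dD t ht).pow 2).add_const (1 ^ 2)).sqrt
      (ne_of_gt (show 0 < D t ^ 2 + 1 ^ 2 by positivity))
    refine this.congr_deriv ?_
    have h := hBpos t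
    simp only [hB₁, Nat.cast_ofNat, Nat.add_one_sub_one, pow_one, Pi.pow_apply]
    change 2 * D t * D₁ t / (2 * B t) = _
    field_simp
  have dA₁ : ∀ t ∈ s, HasDerivAt A₁ (A₂ t) t := fun t ht => by
    refine ((((dx t ht).mul (dξ t ht)).add ((dz t ht).mul (dζ t ht))).div_const 2).congr_deriv ?_
    simp only [hA₂, hq]; ring
  have dD₁ : ∀ t ∈ s, HasDerivAt D₁ (D₂ t) t := fun t ht => by
    refine ((((dx t ht).mul (dξ t ht)).sub ((dz t ht).mul (dζ t ht))).div_const 2).congr_deriv ?_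
    simp only [hD₂, hq]; ring
  have dB₁ : ∀ t ∈ s, HasDerivAt B₁ (B₂ t) t := fun t ht => by
    refine (((dD t ht).mul (dD₁ t ht)).div (dB t ht) (hBpos t).ne').congr_deriv ?_
    have h := hBpos t
    simp only [hB₂, Pi.mul_apply]
    have e : D t * D₁ t = B₁ t * B t := by simp only [hB₁]; field_simp
    rw [e]; field_simp
  have hLpos : ∀ t ∈ s, 0 < A t + B t := fun t ht => by
    have := eigHi_pos (y := 1) (hx t ht) (hz t ht); exact this
  have hMpos : ∀ t ∈ s, 0 < A t - B t := fun t ht => by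
    have := eigLo_pos (y := 1) (hx t ht) (hz t ht) (by simpa using hxz t ht); exact this
  refine ⟨fun t => (A₁ t + B₁ t) * p * (A t + B t) ^ q + (A₁ t - B₁ t) * p * (A t - B t) ^ q,
    fun t => ((A₂ t + B₂ t) * p * (A t + B t) ^ q
        + (A₁ t + B₁ t) * p * ((A₁ t + B₁ t) * q * (A t + B t) ^ (q - 1)))
      + ((A₂ t - B₂ t) * p * (A t - B t) ^ q
        + (A₁ t - B₁ t) * p * ((A₁ t - B₁ t) * q * (A t - B t) ^ (q - 1))),
    fun t ht => ?_, fun t ht => ?_, fun t ht => ?_⟩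
  · exact (((dA t ht).add (dB t ht)).rpow_const (Or.inl (hLpos t ht).ne')).add
      (((dA t ht).sub (dB t ht)).rpow_const (Or.inl (hMpos t ht).ne'))
  · exact ((((dA₁ t ht).add (dB₁ t ht)).mul_const p).mul
        (((dA t ht).add (dB t ht)).rpow_const (Or.inl (hLpos t ht).ne'))).add
      ((((dA₁ t ht).sub (dB₁ t ht)).mul_const p).mul
        (((dA t ht).sub (dB t ht)).rpow_const (Or.inl (hMpos t ht).ne')))
  · have hB0 := hBpos t
    have hx0 := hx t ht
    have hz0 := hz t ht
    have hL := hLpos t ht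
    have hM := hMpos t ht
    have exA : A t + D t = x t := by simp only [hA, hD]; ring
    have ezA : A t - D t = z t := by simp only [hA, hD]; ring
    have el : (A t + B t) ^ q = (A t + B t) ^ (q - 1) * (A t + B t) := by
      rw [Real.rpow_sub_one hL.ne' q, div_mul_cancel₀ _ hL.ne']
    have em : (A t - B t) ^ q = (A t - B t) ^ (q - 1) * (A t - B t) := by
      rw [Real.rpow_sub_one hM.ne' q, div_mul_cancel₀ _ hM.ne']
    have key := eigPowSum_second_deriv_nonneg (q := q) (A := A t) (D := D t) (B := B t)
      (L := A t + B t) (M := A t - B t) (l := (A t + B t) ^ (q - 1)) (k := (A t - B t) ^ (q - 1))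
      (ξ := ξ t) (ζ := ζ t) hB0 (by linarith [hBsq t]) (by rw [exA]; exact hx0.le)
      (by rw [ezA]; exact hz0.le) rfl rfl
      (by rw [← el, ← em]
          exact rpow_sub_rpow_le_trapezoid (by linarith) (by linarith) hM (by linarith))
      (by rw [← el, ← em]
          exact mul_rpow_add_rpow_le (by linarith) (by linarith) hM (by linarith))
      (A₁ := A₁ t) (A₂ := A₂ t) (D₁ := D₁ t) (D₂ := D₂ t) (B₁ := B₁ t) (B₂ := B₂ t)
      (by rw [exA, ezA]) (by rw [exA, ezA]) (by rw [exA, ezA]) (by rw [exA, ezA]) rfl rfl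
    beta_reduce
    rw [el, em]
    have := mul_nonneg (show 0 ≤ p by linarith) key
    refine this.trans (le_of_eq ?_)
    ring

theorem one_lt_segment_mul {X₀ X₁ Z₀ Z₁ a b : ℝ} (hX₀ : 0 < X₀) (hX₁ : 0 < X₁) (hZ₀ : 0 < Z₀)
    (hZ₁ : 0 < Z₁) (h₀ : 1 < X₀ * Z₀) (h₁ : 1 < X₁ * Z₁) (ha : 0 ≤ a) (hb : 0 ≤ b)
    (hab : a + b = 1) : 1 < (a * X₀ + b * X₁) * (a * Z₀ + b * Z₁) := by
  have hc : 2 < X₀ * Z₁ + X₁ * Z₀ := by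
    have h3 : 1 < (X₀ * Z₁) * (X₁ * Z₀) := by nlinarith
    have : 0 < X₀ * Z₁ := by positivity
    have : 0 < X₁ * Z₀ := by positivity
    nlinarith [sq_nonneg (X₀ * Z₁ - X₁ * Z₀)]
  have hb' : b = 1 - a := by linarith
  rcases ha.eq_or_lt with rfl | ha
  · have : b = 1 := by linarith
    subst this; linarith
  · have e : (a * X₀ + b * X₁) * (a * Z₀ + b * Z₁)
      = a ^ 2 * (X₀ * Z₀) + b ^ 2 * (X₁ * Z₁) + a * b * (X₀ * Z₁ + X₁ * Z₀) := by ring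
    have h4 : 0 < a ^ 2 := by positivity
    nlinarith [mul_nonneg ha.le hb, sq_nonneg b, mul_le_mul_of_nonneg_left hc.le
      (mul_nonneg ha.le hb), mul_lt_mul_of_pos_left h₀ h4,
      mul_le_mul_of_nonneg_left h₁.le (sq_nonneg b)]

/-- Strictness in `h₀` and `h₁` keeps the smaller eigenvalue positive along the whole segment, so
its powers can be differentiated twice. -/
theorem eigPowSum_segment_le_of_lt {p : ℝ} (h1 : 1 ≤ p) (h2 : p ≤ 2) {X₀ X₁ Z₀ Z₁ a b : ℝ}
    (hX₀ : 0 < X₀) (hX₁ : 0 < X₁) (hZ₀ : 0 < Z₀) (hZ₁ : 0 < Z₁)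
    (h₀ : 1 < X₀ * Z₀) (h₁ : 1 < X₁ * Z₁) (ha : 0 ≤ a) (hb : 0 ≤ b) (hab : a + b = 1) :
    eigPowSum p ((a * X₀ + b * X₁) ^ (1 / p)) 1 ((a * Z₀ + b * Z₁) ^ (1 / p))
      ≤ a * eigPowSum p (X₀ ^ (1 / p)) 1 (Z₀ ^ (1 / p))
        + b * eigPowSum p (X₁ ^ (1 / p)) 1 (Z₁ ^ (1 / p)) := by
  have hp : 0 < p := by linarith
  set X : ℝ → ℝ := fun t => (1 - t) * X₀ + t * X₁ with hX
  set Z : ℝ → ℝ := fun t => (1 - t) * Z₀ + t * Z₁ with hZ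
  have pos : ∀ {u v : ℝ}, 0 < u → 0 < v → ∀ t ∈ Icc (0 : ℝ) 1, 0 < (1 - t) * u + t * v :=
    fun {u v} hu hv t ht => by
      rcases ht.1.eq_or_lt with rfl | h
      · simpa using hu
      · have := mul_nonneg (sub_nonneg.2 ht.2) hu.le
        have := mul_pos h hv
        linarith
  have dlin : ∀ (u v t : ℝ), HasDerivAt (fun t => (1 - t) * u + t * v) (v - u) t := fun u v t => by
    have := (((hasDerivAt_id t).const_sub 1).mul_const u).add ((hasDerivAt_id t).mul_const v)
    exact this.congr_deriv (by ring)
  have dpow : ∀ {u v : ℝ}, 0 < u → 0 < v → ∀ t ∈ Icc (0 : ℝ) 1,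
      HasDerivAt (fun t => ((1 - t) * u + t * v) ^ (1 / p))
        (((1 - t) * u + t * v) ^ (1 / p) * ((v - u) / (p * ((1 - t) * u + t * v)))) t :=
    fun {u v} hu hv t ht => by
      have h := pos hu hv t ht
      refine ((dlin u v t).rpow_const (Or.inl h.ne')).congr_deriv ?_
      rw [Real.rpow_sub_one h.ne']; field_simp
  have dinv : ∀ {u v : ℝ}, 0 < u → 0 < v → ∀ t ∈ Icc (0 : ℝ) 1,
      HasDerivAt (fun t => (v - u) / (p * ((1 - t) * u + t * v)))
        (-p * ((v - u) / (p * ((1 - t) * u + t * v))) ^ 2) t :=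
    fun {u v} hu hv t ht => by
      have h := pos hu hv t ht
      refine ((hasDerivAt_const t (v - u)).div ((dlin u v t).const_mul p)
        (by positivity)).congr_deriv ?_
      field_simp; ring
  obtain ⟨f', f'', hf', hf'', hnn⟩ := exists_hasDerivAt_eigPowSum h1 h2 (s := Icc 0 1)
    (fun t ht => Real.rpow_pos_of_pos (pos hX₀ hX₁ t ht) (1 / p))
    (fun t ht => Real.rpow_pos_of_pos (pos hZ₀ hZ₁ t ht) (1 / p))
    (fun t ht => by
      rw [← Real.mul_rpow (pos hX₀ hX₁ t ht).le (pos hZ₀ hZ₁ t ht).le]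
      exact Real.one_lt_rpow (one_lt_segment_mul hX₀ hX₁ hZ₀ hZ₁ h₀ h₁ (sub_nonneg.2 ht.2) ht.1
        (by ring)) (by positivity))
    (dpow hX₀ hX₁) (dpow hZ₀ hZ₁) (dinv hX₀ hX₁) (dinv hZ₀ hZ₁)
  have hconv := convexOn_of_hasDerivWithinAt2_nonneg (convex_Icc (0 : ℝ) 1)
    (fun t ht => (hf' t ht).continuousAt.continuousWithinAt)
    (fun t ht => (hf' t (interior_subset ht)).hasDerivWithinAt)
    (fun t ht => (hf'' t (interior_subset ht)).hasDerivWithinAt)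
    (fun t ht => hnn t (interior_subset ht))
  have := hconv.2 (left_mem_Icc.2 zero_le_one) (right_mem_Icc.2 zero_le_one) ha hb hab
  have ea : 1 - b = a := by linarith
  simpa [ea] using this

theorem continuous_eigPowSum_rpow {p : ℝ} (h1 : 1 ≤ p) (X Z : ℝ) :
    Continuous fun c : ℝ => eigPowSum p ((c * X) ^ (1 / p)) 1 ((c * Z) ^ (1 / p)) := by
  have hp : 0 ≤ p := by linarith
  have hp' : 0 ≤ 1 / p := by positivity
  have c1 : Continuous fun c : ℝ => (c * X) ^ (1 / p) :=
    (continuous_id.mul continuous_const).rpow_const fun _ => Or.inr hp'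
  have c2 : Continuous fun c : ℝ => (c * Z) ^ (1 / p) :=
    (continuous_id.mul continuous_const).rpow_const fun _ => Or.inr hp'
  unfold eigPowSum eigHi eigLo
  have c3 := (((c1.sub c2).div_const 2).pow 2).add (continuous_const (y := (1 : ℝ) ^ 2)) |>.sqrt
  exact ((((c1.add c2).div_const 2).add c3).rpow_const fun _ => Or.inr hp).add
    ((((c1.add c2).div_const 2).sub c3).rpow_const fun _ => Or.inr hp)

theorem eigPowSum_segment_le {p : ℝ} (h1 : 1 ≤ p) (h2 : p ≤ 2) {X₀ X₁ Z₀ Z₁ a b : ℝ}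
    (hX₀ : 0 < X₀) (hX₁ : 0 < X₁) (hZ₀ : 0 < Z₀) (hZ₁ : 0 < Z₁)
    (h₀ : 1 ≤ X₀ * Z₀) (h₁ : 1 ≤ X₁ * Z₁) (ha : 0 ≤ a) (hb : 0 ≤ b) (hab : a + b = 1) :
    eigPowSum p ((a * X₀ + b * X₁) ^ (1 / p)) 1 ((a * Z₀ + b * Z₁) ^ (1 / p))
      ≤ a * eigPowSum p (X₀ ^ (1 / p)) 1 (Z₀ ^ (1 / p))
        + b * eigPowSum p (X₁ ^ (1 / p)) 1 (Z₁ ^ (1 / p)) := by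
  have t1 : ∀ X Z : ℝ, Tendsto
      (fun c : ℝ => eigPowSum p ((c * X) ^ (1 / p)) 1 ((c * Z) ^ (1 / p))) (𝓝[>] 1)
      (𝓝 (eigPowSum p (X ^ (1 / p)) 1 (Z ^ (1 / p)))) := fun X Z => by
    have := (continuous_eigPowSum_rpow h1 X Z).tendsto 1
    simp only [one_mul] at this
    exact this.mono_left nhdsWithin_le_nhds
  -- Scaling by `c > 1` makes the constraints strict; then `c` tends to `1`.
  refine le_of_tendsto_of_tendsto (t1 (a * X₀ + b * X₁) (a * Z₀ + b * Z₁))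
    (((t1 X₀ Z₀).const_mul a).add ((t1 X₁ Z₁).const_mul b)) ?_
  filter_upwards [self_mem_nhdsWithin] with c hc
  have hc : 1 < c := hc
  have hcc : 1 < c * c := by nlinarith
  have := eigPowSum_segment_le_of_lt h1 h2 (X₀ := c * X₀) (X₁ := c * X₁) (Z₀ := c * Z₀)
    (Z₁ := c * Z₁) (by positivity) (by positivity) (by positivity) (by positivity)
    (by nlinarith) (by nlinarith) ha hb hab
  rw [show a * (c * X₀) + b * (c * X₁) = c * (a * X₀ + b * X₁) by ring,
    show a * (c * Z₀) + b * (c * Z₁) = c * (a * Z₀ + b * Z₁) by ring] at this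
  exact this

theorem convexOn_eigPowSum {p : ℝ} (h1 : 1 ≤ p) (h2 : p ≤ 2) :
    ConvexOn ℝ {P : ℝ × ℝ | 0 < P.1 ∧ 0 < P.2 ∧ 1 ≤ P.1 * P.2}
      (fun P => eigPowSum p (P.1 ^ (1 / p)) 1 (P.2 ^ (1 / p))) := by
  refine ⟨?_, ?_⟩
  · rintro ⟨X₀, Z₀⟩ ⟨hX₀, hZ₀, h₀⟩ ⟨X₁, Z₁⟩ ⟨hX₁, hZ₁, h₁⟩ a b ha hb hab
    simp only [Prod.smul_mk, Prod.mk_add_mk, smul_eq_mul, mem_ofPred_eq] at *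
    have pos : ∀ {u v : ℝ}, 0 < u → 0 < v → 0 < a * u + b * v := fun {u v} hu hv => by
      rcases ha.eq_or_lt with rfl | h
      · have : b = 1 := by linarith
        subst this; simpa using hv
      · have := mul_nonneg hb hv.le
        have := mul_pos h hu
        linarith
    refine ⟨pos hX₀ hX₁, pos hZ₀ hZ₁, ?_⟩
    have hc : 2 ≤ X₀ * Z₁ + X₁ * Z₀ := by
      have h3 : 1 ≤ (X₀ * Z₁) * (X₁ * Z₀) := by nlinarith
      have : 0 < X₀ * Z₁ := by positivity
      have : 0 < X₁ * Z₀ := by positivity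
      nlinarith [sq_nonneg (X₀ * Z₁ - X₁ * Z₀)]
    have hb' : b = 1 - a := by linarith
    nlinarith [mul_le_mul_of_nonneg_left hc (mul_nonneg ha hb),
      mul_le_mul_of_nonneg_left h₀ (sq_nonneg a), mul_le_mul_of_nonneg_left h₁ (sq_nonneg b)]
  · rintro ⟨X₀, Z₀⟩ ⟨hX₀, hZ₀, h₀⟩ ⟨X₁, Z₁⟩ ⟨hX₁, hZ₁, h₁⟩ a b ha hb hab
    exact eigPowSum_segment_le h1 h2 hX₀ hX₁ hZ₀ hZ₁ h₀ h₁ ha hb hab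

/-- Superadditivity of the `p`-th power sum of the eigenvalues of `2 × 2` positive semidefinite
matrices with respect to `ℓ^p` sums of the entries, when all the off-diagonal entries are
positive. -/
theorem eigPowSum_lp_le_sum_of_pos {p : ℝ} (h1 : 1 ≤ p) (h2 : p ≤ 2) {ι : Type*} {s : Finset ι}
    (hs : s.Nonempty) {x y z : ι → ℝ} (hx : ∀ i ∈ s, 0 ≤ x i) (hz : ∀ i ∈ s, 0 ≤ z i)
    (hy : ∀ i ∈ s, 0 < y i) (h : ∀ i ∈ s, y i ^ 2 ≤ x i * z i) :
    eigPowSum p ((∑ i ∈ s, x i ^ p) ^ (1 / p)) ((∑ i ∈ s, y i ^ p) ^ (1 / p))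
      ((∑ i ∈ s, z i ^ p) ^ (1 / p)) ≤ ∑ i ∈ s, eigPowSum p (x i) (y i) (z i) := by
  have hp : 0 < p := by linarith
  set S := ∑ i ∈ s, y i ^ p with hS
  have hSpos : 0 < S := Finset.sum_pos (fun i hi => Real.rpow_pos_of_pos (hy i hi) p) hs
  have hxp : ∀ i ∈ s, 0 < x i := fun i hi =>
    (hx i hi).lt_of_ne fun e => by
      have := h i hi; rw [← e, zero_mul] at this; have := hy i hi; nlinarith
  have hzp : ∀ i ∈ s, 0 < z i := fun i hi =>
    (hz i hi).lt_of_ne fun e => by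
      have := h i hi; rw [← e, mul_zero] at this; have := hy i hi; nlinarith
  have hmem : ∀ i ∈ s, ((x i / y i) ^ p, (z i / y i) ^ p)
      ∈ {P : ℝ × ℝ | 0 < P.1 ∧ 0 < P.2 ∧ 1 ≤ P.1 * P.2} := fun i hi => by
    have hxi := hxp i hi
    have hyi := hy i hi
    have hzi := hzp i hi
    refine ⟨by positivity, by positivity, ?_⟩
    simp only
    rw [← Real.mul_rpow (by positivity) (by positivity)]
    refine Real.one_le_rpow ?_ hp.le
    rw [div_mul_div_comm, one_le_div (by positivity)]
    nlinarith [h i hi]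
  -- Each matrix is normalized to off-diagonal entry `1`; homogeneity of degree `p` turns the factor
  -- `y i` into the Jensen weight `y i ^ p / S`.
  have hJ := (convexOn_eigPowSum h1 h2).map_sum_le (t := s) (w := fun i => y i ^ p / S)
    (p := fun i => ((x i / y i) ^ p, (z i / y i) ^ p))
    (fun i hi => by have := hy i hi; positivity)
    (by rw [← Finset.sum_div, ← hS, div_self hSpos.ne']) hmem
  have hcone := (convexOn_eigPowSum h1 h2).1.sum_mem (t := s) (w := fun i => y i ^ p / S)
    (z := fun i => ((x i / y i) ^ p, (z i / y i) ^ p))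
    (fun i hi => by have := hy i hi; positivity)
    (by rw [← Finset.sum_div, ← hS, div_self hSpos.ne']) hmem
  have efst : (∑ i ∈ s, (y i ^ p / S) • ((x i / y i) ^ p, (z i / y i) ^ p))
      = ((∑ i ∈ s, x i ^ p) / S, (∑ i ∈ s, z i ^ p) / S) := by
    rw [Prod.ext_iff, Prod.fst_sum, Prod.snd_sum]
    simp only [Prod.smul_mk, smul_eq_mul, Finset.sum_div]
    constructor <;> refine Finset.sum_congr rfl fun i hi => ?_
    · have hyi := hy i hi
      rw [Real.div_rpow (hxp i hi).le hyi.le]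
      have : y i ^ p ≠ 0 := (Real.rpow_pos_of_pos hyi p).ne'
      field_simp
    · have hyi := hy i hi
      rw [Real.div_rpow (hzp i hi).le hyi.le]
      have : y i ^ p ≠ 0 := (Real.rpow_pos_of_pos hyi p).ne'
      field_simp
  rw [efst] at hJ hcone
  obtain ⟨c1, c2, c3⟩ := hcone
  simp only at c1 c2 c3
  simp only [smul_eq_mul] at hJ
  have hterm : ∀ i ∈ s, y i ^ p / S * eigPowSum p (((x i / y i) ^ p) ^ (1 / p)) 1
      (((z i / y i) ^ p) ^ (1 / p)) = eigPowSum p (x i) (y i) (z i) / S := fun i hi => by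
    have hxi := hxp i hi
    have hyi := hy i hi
    have hzi := hzp i hi
    rw [one_div, Real.rpow_rpow_inv (by positivity) hp.ne', Real.rpow_rpow_inv (by positivity) hp.ne',
      div_mul_eq_mul_div, ← eigPowSum_mul p hyi.le (by positivity) (by positivity)
      (by rw [div_mul_div_comm, one_pow, one_le_div (by positivity)]; nlinarith [h i hi])]
    congr 2 <;> field_simp
  rw [Finset.sum_congr rfl hterm, ← Finset.sum_div, le_div_iff₀ hSpos] at hJ
  refine le_trans (le_of_eq ?_) hJ
  have hsx : 0 ≤ ∑ i ∈ s, x i ^ p := Finset.sum_nonneg fun i hi => Real.rpow_nonneg (hx i hi) p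
  have hsz : 0 ≤ ∑ i ∈ s, z i ^ p := Finset.sum_nonneg fun i hi => Real.rpow_nonneg (hz i hi) p
  have hSp : (S ^ (1 / p)) ^ p = S := by
    rw [one_div, Real.rpow_inv_rpow hSpos.le hp.ne']
  have hm := eigPowSum_mul (c := S ^ (1 / p)) (y := 1) p (by positivity)
    (Real.rpow_nonneg c1.le (1 / p)) (Real.rpow_nonneg c2.le (1 / p))
    (by rw [← Real.mul_rpow c1.le c2.le, one_pow]; exact Real.one_le_rpow c3 (by positivity))
  rw [hSp] at hm
  rw [mul_comm, ← hm, mul_one, Real.div_rpow hsx hSpos.le, Real.div_rpow hsz hSpos.le]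
  have : S ^ (1 / p) ≠ 0 := (Real.rpow_pos_of_pos hSpos _).ne'
  congr 1 <;> field_simp

end Jensen

/-! ### Superadditivity of the excess over the diagonal -/

section Defect

open MeasureTheory Set Filter Topology

/-- Cauchy–Schwarz applied to the `p`-th powers; it keeps the matrix of `ℓ^p` sums positive
semidefinite. -/
theorem sq_lp_le_mul_lp {p : ℝ} (hp : 0 < p) {ι : Type*} (s : Finset ι)
    {x y z : ι → ℝ} (hx : ∀ i, 0 ≤ x i) (hz : ∀ i, 0 ≤ z i) (hy : ∀ i, 0 ≤ y i)
    (h : ∀ i, y i ^ 2 ≤ x i * z i) :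
    ((∑ i ∈ s, y i ^ p) ^ (1 / p)) ^ 2
      ≤ (∑ i ∈ s, x i ^ p) ^ (1 / p) * (∑ i ∈ s, z i ^ p) ^ (1 / p) := by
  have hsx : 0 ≤ ∑ i ∈ s, x i ^ p := Finset.sum_nonneg fun i _ => Real.rpow_nonneg (hx i) p
  have hsz : 0 ≤ ∑ i ∈ s, z i ^ p := Finset.sum_nonneg fun i _ => Real.rpow_nonneg (hz i) p
  have hsy : 0 ≤ ∑ i ∈ s, y i ^ p := Finset.sum_nonneg fun i _ => Real.rpow_nonneg (hy i) p
  rw [← Real.mul_rpow hsx hsz, ← Real.rpow_natCast, ← Real.rpow_mul hsy,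
    mul_comm, Real.rpow_mul hsy]
  refine Real.rpow_le_rpow (by positivity) ?_ (by positivity)
  rw [Nat.cast_ofNat, Real.rpow_ofNat]
  refine Finset.sum_sq_le_sum_mul_sum_of_sq_le_mul s (fun i _ => Real.rpow_nonneg (hx i) p)
    (fun i _ => Real.rpow_nonneg (hz i) p) fun i _ => ?_
  rw [← Real.mul_rpow (hx i) (hz i), ← Real.rpow_natCast, ← Real.rpow_mul (hy i), mul_comm p,
    Real.rpow_mul (hy i), Nat.cast_ofNat, Real.rpow_ofNat]
  exact Real.rpow_le_rpow (sq_nonneg _) (h i) hp.le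

/-- Superadditivity of the excess of the `p`-th power sum of eigenvalues over the `p`-th power sum
of the diagonal entries. -/
theorem eigPowSum_sub_le_sum {p : ℝ} (h1 : 1 ≤ p) (h2 : p ≤ 2) {ι : Type*} [Fintype ι]
    {x y z : ι → ℝ} (hx : ∀ i, 0 ≤ x i) (hz : ∀ i, 0 ≤ z i)
    (hy : ∀ i, 0 ≤ y i) (h : ∀ i, y i ^ 2 ≤ x i * z i) {a c : ℝ} (ha : 0 ≤ a) (hc : 0 ≤ c)
    (hxa : ∑ i, x i ^ p ≤ a ^ p) (hzc : ∑ i, z i ^ p ≤ c ^ p) :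
    eigPowSum p a ((∑ i, y i ^ p) ^ (1 / p)) c - a ^ p - c ^ p
      ≤ ∑ i, (eigPowSum p (x i) (y i) (z i) - x i ^ p - z i ^ p) := by
  classical
  have hp : 0 < p := by linarith
  -- Indices with `y i = 0` have zero excess. Dropping them only shrinks the diagonal sums, which
  -- antitonicity of the excess absorbs.
  set s : Finset ι := Finset.univ.filter fun i => 0 < y i with hs
  have hzero : ∀ i ∉ s, y i = 0 := fun i hi => by
    simp only [hs, Finset.mem_filter, Finset.mem_univ, true_and, not_lt] at hi
    exact le_antisymm hi (hy i)
  have hrhs : ∑ i, (eigPowSum p (x i) (y i) (z i) - x i ^ p - z i ^ p)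
      = ∑ i ∈ s, (eigPowSum p (x i) (y i) (z i) - x i ^ p - z i ^ p) := by
    refine (Finset.sum_subset (Finset.subset_univ s) fun i _ hi => ?_).symm
    rw [hzero i hi, eigPowSum_zero]; ring
  have hysum : ∑ i, y i ^ p = ∑ i ∈ s, y i ^ p := by
    refine (Finset.sum_subset (Finset.subset_univ s) fun i _ hi => ?_).symm
    rw [hzero i hi, Real.zero_rpow hp.ne']
  rw [hrhs, hysum]
  rcases s.eq_empty_or_nonempty with he | hne
  · rw [he]
    simp only [Finset.sum_empty]
    rw [Real.zero_rpow (by positivity), eigPowSum_zero]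
    linarith
  · have hys : ∀ i ∈ s, 0 < y i := fun i hi => (Finset.mem_filter.1 hi).2
    have hmain := eigPowSum_lp_le_sum_of_pos h1 h2 hne (fun i _ => hx i) (fun i _ => hz i) hys
      (fun i _ => h i)
    have hsx : 0 ≤ ∑ i ∈ s, x i ^ p := Finset.sum_nonneg fun i _ => Real.rpow_nonneg (hx i) p
    have hsz : 0 ≤ ∑ i ∈ s, z i ^ p := Finset.sum_nonneg fun i _ => Real.rpow_nonneg (hz i) p
    have pw : ∀ {u : ℝ}, 0 ≤ u → (u ^ (1 / p)) ^ p = u := fun hu => by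
      rw [one_div, Real.rpow_inv_rpow hu hp.ne']
    have lepow : ∀ {f : ι → ℝ} {b : ℝ}, (∀ i, 0 ≤ f i) → 0 ≤ b → ∑ i, f i ^ p ≤ b ^ p →
        (∑ i ∈ s, f i ^ p) ^ (1 / p) ≤ b := fun {f b} hf hb hfb => by
      have h3 : ∑ i ∈ s, f i ^ p ≤ b ^ p :=
        (Finset.sum_le_univ_sum_of_nonneg fun i => Real.rpow_nonneg (hf i) p).trans hfb
      calc (∑ i ∈ s, f i ^ p) ^ (1 / p) ≤ (b ^ p) ^ (1 / p) :=
            Real.rpow_le_rpow (Finset.sum_nonneg fun i _ => Real.rpow_nonneg (hf i) p) h3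
              (by positivity)
        _ = b := by rw [one_div, Real.rpow_rpow_inv hb hp.ne']
    have hcs := sq_lp_le_mul_lp hp s hx hz hy h
    have hanti := eigPowSum_sub_antitone h1 h2 (by positivity) (lepow hx ha hxa) (by positivity)
      (lepow hz hc hzc) hcs
    rw [pw hsx, pw hsz] at hanti
    simp only [Finset.sum_sub_distrib]
    linarith

end Defect

/-! ### Second-order comparison of products -/

section ProdOneAdd

open MeasureTheory Set Filter Topology

/-- The difference of `∑ log (1 + t * k i)` and `∑ log (1 + t * k₀ i)` vanishes to first order at `t
= 0` and is concave on `[0, 1]`, hence is nonpositive at `t = 1`. -/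
theorem prod_one_add_le_of_sum_sq_div_le {ι : Type*} [Fintype ι] {k k₀ : ι → ℝ}
    (hk : ∀ i, 0 < 1 + k i) (hk₀ : ∀ i, 0 < 1 + k₀ i) (hs : ∑ i, k i = 0) (hs₀ : ∑ i, k₀ i = 0)
    (h : ∀ t ∈ Icc (0 : ℝ) 1,
      ∑ i, (k₀ i / (1 + t * k₀ i)) ^ 2 ≤ ∑ i, (k i / (1 + t * k i)) ^ 2) :
    ∏ i, (1 + k i) ≤ ∏ i, (1 + k₀ i) := by
  have pos : ∀ {u t : ℝ}, 0 < 1 + u → t ∈ Icc (0 : ℝ) 1 → 0 < 1 + t * u := fun {u t} hu ht => by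
    rcases ht.1.eq_or_lt with rfl | h0
    · simp
    · nlinarith [ht.2]
  have d1 : ∀ {u t : ℝ}, 0 < 1 + u → t ∈ Icc (0 : ℝ) 1 →
      HasDerivAt (fun t => Real.log (1 + t * u)) (u / (1 + t * u)) t := fun {u t} hu ht => by
    have := (((hasDerivAt_id t).mul_const u).const_add 1).log (pos hu ht).ne'
    simpa using this
  have d2 : ∀ {u t : ℝ}, 0 < 1 + u → t ∈ Icc (0 : ℝ) 1 →
      HasDerivAt (fun t => u / (1 + t * u)) (-(u / (1 + t * u)) ^ 2) t := fun {u t} hu ht => by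
    have := (hasDerivAt_const t u).div (((hasDerivAt_id t).mul_const u).const_add 1)
      (pos hu ht).ne'
    refine this.congr_deriv ?_
    have := pos hu ht
    simp only [id]
    field_simp
    ring
  have D1 : ∀ t ∈ Icc (0 : ℝ) 1, HasDerivAt
      (fun t => ∑ i, Real.log (1 + t * k i) - ∑ i, Real.log (1 + t * k₀ i))
      (∑ i, k i / (1 + t * k i) - ∑ i, k₀ i / (1 + t * k₀ i)) t := fun t ht =>
    (HasDerivAt.fun_sum fun i _ => d1 (hk i) ht).sub (HasDerivAt.fun_sum fun i _ => d1 (hk₀ i) ht)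
  have D2 : ∀ t ∈ Icc (0 : ℝ) 1, HasDerivAt
      (fun t => ∑ i, k i / (1 + t * k i) - ∑ i, k₀ i / (1 + t * k₀ i))
      (∑ i, -(k i / (1 + t * k i)) ^ 2 - ∑ i, -(k₀ i / (1 + t * k₀ i)) ^ 2) t := fun t ht =>
    (HasDerivAt.fun_sum fun i _ => d2 (hk i) ht).sub (HasDerivAt.fun_sum fun i _ => d2 (hk₀ i) ht)
  have A2 := antitoneOn_of_hasDerivWithinAt_nonpos (convex_Icc (0 : ℝ) 1)
    (fun t ht => (D2 t ht).continuousAt.continuousWithinAt)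
    (fun t ht => (D2 t (interior_subset ht)).hasDerivWithinAt) (fun t ht => by
      simp only [Finset.sum_neg_distrib]
      linarith [h t (interior_subset ht)])
  have A1 := antitoneOn_of_hasDerivWithinAt_nonpos (convex_Icc (0 : ℝ) 1)
    (fun t ht => (D1 t ht).continuousAt.continuousWithinAt)
    (fun t ht => (D1 t (interior_subset ht)).hasDerivWithinAt) (fun t ht => by
      have ht := interior_subset ht
      have := A2 (left_mem_Icc.2 zero_le_one) ht ht.1
      simpa [hs, hs₀] using this)
  have := A1 (left_mem_Icc.2 zero_le_one) (right_mem_Icc.2 zero_le_one) zero_le_one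
  simp only [one_mul, zero_mul, add_zero, Real.log_one, Finset.sum_const_zero, sub_zero] at this
  rw [← Real.log_prod fun i _ => (hk i).ne', ← Real.log_prod fun i _ => (hk₀ i).ne',
    sub_nonpos] at this
  exact (Real.log_le_log_iff (Finset.prod_pos fun i _ => hk i)
    (Finset.prod_pos fun i _ => hk₀ i)).1 this

end ProdOneAdd

/-! ### Pencils `E + tK` and convexity of `tr (A⁻¹KA⁻¹K)` -/

section SimultaneousDiagonalization

open Matrix
open scoped MatrixOrder

variable {ι : Type*} [Fintype ι] [DecidableEq ι]

theorem Matrix.IsHermitian.exists_unitary_diagonal {𝕜 : Type*} [RCLike 𝕜] {A : Matrix ι ι 𝕜}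
    (hA : A.IsHermitian) :
    ∃ U : Matrix ι ι 𝕜, Uᴴ * U = 1 ∧ U * Uᴴ = 1 ∧
      A = U * diagonal (fun i => (hA.eigenvalues i : 𝕜)) * Uᴴ := by
  refine ⟨hA.eigenvectorUnitary, Unitary.coe_star_mul_self _, Unitary.coe_mul_star_self _, ?_⟩
  have := hA.spectral_theorem
  rw [Unitary.conjStarAlgAut_apply] at this
  exact this

/-- A positive definite matrix and a Hermitian matrix are simultaneously diagonalizable by
congruence. -/
theorem Matrix.PosDef.exists_congruence_diagonal {E K : Matrix ι ι ℂ} (hE : E.PosDef)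
    (hK : K.IsHermitian) :
    ∃ (C : Matrix ι ι ℂ) (k : ι → ℝ), IsUnit C ∧ E = Cᴴ * C ∧
      K = Cᴴ * diagonal (fun i => (k i : ℂ)) * C := by
  obtain ⟨B, hB⟩ := CStarAlgebra.nonneg_iff_eq_star_mul_self.1 hE.posSemidef.nonneg
  rw [star_eq_conjTranspose] at hB
  have hBu : IsUnit B := by
    have := hE.isUnit
    rw [hB, isUnit_iff_isUnit_det, det_mul] at this
    exact (isUnit_iff_isUnit_det B).2 (isUnit_of_mul_isUnit_right this)
  have hBd : IsUnit B.det := (isUnit_iff_isUnit_det B).1 hBu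
  have hBd' : IsUnit Bᴴ.det := by rw [det_conjTranspose]; exact hBd.star
  have hK' : (B⁻¹ᴴ * K * B⁻¹).IsHermitian := isHermitian_conjTranspose_mul_mul _ hK
  obtain ⟨U, hU1, hU2, hU⟩ := hK'.exists_unitary_diagonal
  generalize hK'.eigenvalues = k at hU
  -- With `E = B* B`, the unitary `U` diagonalizes `B⁻¹* K B⁻¹`.
  refine ⟨Uᴴ * B, k, ?_, ?_, ?_⟩
  · refine IsUnit.mul ?_ hBu
    exact (isUnit_iff_isUnit_det _).2 (isUnit_det_of_left_inverse hU2)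
  · rw [conjTranspose_mul, conjTranspose_conjTranspose, Matrix.mul_assoc, ← Matrix.mul_assoc U,
      hU2, Matrix.one_mul, hB]
  · rw [conjTranspose_mul, conjTranspose_conjTranspose]
    calc K = Bᴴ * (B⁻¹ᴴ * K * B⁻¹) * B := by
          rw [conjTranspose_nonsing_inv]
          simp only [Matrix.mul_assoc]
          rw [nonsing_inv_mul _ hBd, Matrix.mul_one, mul_nonsing_inv_cancel_left _ _ hBd']
      _ = _ := by
          rw [hU]
          simp only [Matrix.mul_assoc]
          rfl

theorem conjTranspose_mul_diagonal_mul_inv {C : Matrix ι ι ℂ} (hC : IsUnit C) {d : ι → ℂ}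
    (hd : ∀ i, d i ≠ 0) :
    (Cᴴ * diagonal d * C)⁻¹ = C⁻¹ * diagonal (fun i => (d i)⁻¹) * Cᴴ⁻¹ := by
  have hCd : IsUnit C.det := (isUnit_iff_isUnit_det C).1 hC
  have hCd' : IsUnit Cᴴ.det := by rw [det_conjTranspose]; exact hCd.star
  refine inv_eq_left_inv ?_
  calc C⁻¹ * diagonal (fun i => (d i)⁻¹) * Cᴴ⁻¹ * (Cᴴ * diagonal d * C)
      = C⁻¹ * (diagonal (fun i => (d i)⁻¹) * ((Cᴴ⁻¹ * Cᴴ) * diagonal d)) * C := by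
        simp only [Matrix.mul_assoc]
    _ = 1 := by
        rw [nonsing_inv_mul _ hCd', Matrix.one_mul, diagonal_mul_diagonal]
        simp only [inv_mul_cancel₀ (hd _), diagonal_one, Matrix.mul_one]
        exact nonsing_inv_mul _ hCd

theorem trace_congruence {C : Matrix ι ι ℂ} (hC : IsUnit C) (F G : Matrix ι ι ℂ) :
    (C⁻¹ * F * Cᴴ⁻¹ * (Cᴴ * G * C)).trace = (F * G).trace := by
  have hCd : IsUnit C.det := (isUnit_iff_isUnit_det C).1 hC
  have hCd' : IsUnit Cᴴ.det := by rw [det_conjTranspose]; exact hCd.star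
  rw [trace_mul_comm]
  simp only [Matrix.mul_assoc]
  rw [mul_nonsing_inv_cancel_left _ _ hCd, trace_mul_comm]
  simp only [Matrix.mul_assoc]
  rw [nonsing_inv_mul _ hCd', Matrix.mul_one, trace_mul_comm]

theorem congruence_mul_congruence {C : Matrix ι ι ℂ} (hC : IsUnit C) (F G H : Matrix ι ι ℂ) :
    (C⁻¹ * F * Cᴴ⁻¹) * (Cᴴ * G * C) * (C⁻¹ * H * Cᴴ⁻¹) = C⁻¹ * (F * G * H) * Cᴴ⁻¹ := by
  have hCd : IsUnit C.det := (isUnit_iff_isUnit_det C).1 hC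
  have hCd' : IsUnit Cᴴ.det := by rw [det_conjTranspose]; exact hCd.star
  simp only [Matrix.mul_assoc]
  rw [nonsing_inv_mul_cancel_left _ _ hCd', mul_nonsing_inv_cancel_left _ _ hCd]

/-- Simultaneous spectral data of a pencil `E + t K` with `E` positive definite. -/
theorem exists_pencil_spectrum {E K : Matrix ι ι ℂ} (hE : E.PosDef) (hK : K.IsHermitian) :
    ∃ k : ι → ℝ, (E⁻¹ * K).trace = ((∑ i, k i : ℝ) : ℂ) ∧
      ∀ t : ℝ, (E + (t : ℂ) • K).det = E.det * ((∏ i, (1 + t * k i) : ℝ) : ℂ) ∧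
        ((E + (t : ℂ) • K).PosDef → (∀ i, 0 < 1 + t * k i) ∧
          ((E + (t : ℂ) • K)⁻¹ * K * (E + (t : ℂ) • K)⁻¹ * K).trace
            = ((∑ i, (k i / (1 + t * k i)) ^ 2 : ℝ) : ℂ)) := by
  obtain ⟨C, k, hC, hEC, hKC⟩ := hE.exists_congruence_diagonal hK
  have hpen : ∀ t : ℝ, E + (t : ℂ) • K
      = Cᴴ * diagonal (fun i => ((1 + t * k i : ℝ) : ℂ)) * C := fun t => by
    have : (diagonal (fun i => ((1 + t * k i : ℝ) : ℂ)) : Matrix ι ι ℂ)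
        = 1 + (t : ℂ) • diagonal (fun i => (k i : ℂ)) := by
      rw [← diagonal_one, ← diagonal_smul, diagonal_add]
      congr 1; funext i; simp
    rw [this, hEC, hKC]
    simp only [Matrix.mul_add, Matrix.add_mul, Matrix.mul_one, Matrix.mul_smul, Matrix.smul_mul]
  have hE1 : E = Cᴴ * diagonal (fun _ => (1 : ℂ)) * C := by
    rw [diagonal_one, Matrix.mul_one, hEC]
  refine ⟨k, ?_, fun t => ⟨?_, fun hpd => ?_⟩⟩
  · rw [hE1, conjTranspose_mul_diagonal_mul_inv hC (fun _ => one_ne_zero), hKC,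
      trace_congruence hC, diagonal_mul_diagonal, trace_diagonal]
    simp
  · rw [hpen, hEC, det_mul, det_mul, det_mul, det_diagonal]
    push_cast
    ring
  · rw [hpen] at hpd ⊢
    have hpos : ∀ i, 0 < 1 + t * k i := fun i => by
      have := (Matrix.IsUnit.posDef_star_left_conjugate_iff hC).1 hpd
      have := (posDef_diagonal_iff.1 this) i
      exact_mod_cast this
    refine ⟨hpos, ?_⟩
    rw [conjTranspose_mul_diagonal_mul_inv hC
      (fun i => by exact_mod_cast (hpos i).ne'), hKC, congruence_mul_congruence hC,
      trace_congruence hC]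
    simp only [diagonal_mul_diagonal, trace_diagonal]
    push_cast
    refine Finset.sum_congr rfl fun i _ => ?_
    ring

theorem trace_diagonal_mul_diagonal_mul (K : Matrix ι ι ℂ) (hK : K.IsHermitian) (a b : ι → ℝ) :
    (diagonal (fun i => (a i : ℂ)) * K * diagonal (fun i => (b i : ℂ)) * K).trace
      = ((∑ i, ∑ j, a i * b j * Complex.normSq (K i j) : ℝ) : ℂ) := by
  simp only [trace, diag_apply, mul_apply (M := _ * _) (N := K), mul_diagonal, diagonal_mul]
  push_cast
  refine Finset.sum_congr rfl fun i _ => Finset.sum_congr rfl fun j _ => ?_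
  rw [← Complex.mul_conj, ← hK.apply j i]
  simp only [RCLike.star_def]
  ring

/-- The left side is the tangent plane at `(1, 1)` of the convex function `1 / (ab)`. -/
theorem three_sub_sub_le_inv_mul_inv {a b : ℝ} (ha : 0 < a) (hb : 0 < b) :
    3 - a - b ≤ a⁻¹ * b⁻¹ := by
  rw [← mul_inv, ← one_div, le_div_iff₀ (by positivity)]
  nlinarith [mul_nonneg (add_pos ha hb).le (sq_nonneg (a - b)),
    mul_nonneg (add_pos ha hb).le (sq_nonneg (a + b - 2)), sq_nonneg (a + b - 2),
    sq_nonneg (a - b), mul_pos ha hb]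

/-- Tangent inequality for the convex function `A ↦ tr (A⁻¹ K A⁻¹ K)`. -/
theorem trace_inv_mul_mul_inv_mul_ge {A A₀ K : Matrix ι ι ℂ} (hA : A.PosDef) (hA₀ : A₀.PosDef)
    (hK : K.IsHermitian)
    -- This says that the derivative at `A₀` in the direction `A - A₀` is zero.
    (h : (A * (A₀⁻¹ * K * A₀⁻¹ * K * A₀⁻¹)).trace = (A₀⁻¹ * K * A₀⁻¹ * K).trace) :
    (A₀⁻¹ * K * A₀⁻¹ * K).trace.re ≤ (A⁻¹ * K * A⁻¹ * K).trace.re := by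
  obtain ⟨C, a, hC, hEC, hAC⟩ := hA₀.exists_congruence_diagonal hA.isHermitian
  have hCd : IsUnit C.det := (isUnit_iff_isUnit_det C).1 hC
  have hCd' : IsUnit Cᴴ.det := by rw [det_conjTranspose]; exact hCd.star
  have ha : ∀ i, 0 < a i := fun i => by
    rw [hAC] at hA
    have := (Matrix.IsUnit.posDef_star_left_conjugate_iff hC).1 hA
    exact_mod_cast (posDef_diagonal_iff.1 this) i
  set L : Matrix ι ι ℂ := C⁻¹ᴴ * K * C⁻¹ with hL
  have hLh : L.IsHermitian := isHermitian_conjTranspose_mul_mul _ hK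
  have hKL : K = Cᴴ * L * C := by
    rw [hL, conjTranspose_nonsing_inv]
    simp only [Matrix.mul_assoc]
    rw [nonsing_inv_mul _ hCd, Matrix.mul_one, mul_nonsing_inv_cancel_left _ _ hCd']
  have hA₀1 : A₀ = Cᴴ * diagonal (fun _ => ((1 : ℝ) : ℂ)) * C := by
    rw [Complex.ofReal_one, diagonal_one, Matrix.mul_one, hEC]
  have hinv₀ : A₀⁻¹ = C⁻¹ * diagonal (fun _ => ((1 : ℝ) : ℂ)) * Cᴴ⁻¹ := by
    rw [hA₀1, conjTranspose_mul_diagonal_mul_inv hC (fun _ => by simp)]; simp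
  have hinv : A⁻¹ = C⁻¹ * diagonal (fun i => (((a i)⁻¹ : ℝ) : ℂ)) * Cᴴ⁻¹ := by
    rw [hAC, conjTranspose_mul_diagonal_mul_inv hC
      (fun i => by exact_mod_cast (ha i).ne')]
    simp
  have e0 : (A₀⁻¹ * K * A₀⁻¹ * K).trace
      = ((∑ i, ∑ j, 1 * 1 * Complex.normSq (L i j) : ℝ) : ℂ) := by
    rw [hinv₀, hKL, congruence_mul_congruence hC, trace_congruence hC,
      trace_diagonal_mul_diagonal_mul L hLh]
  have e1 : (A⁻¹ * K * A⁻¹ * K).trace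
      = ((∑ i, ∑ j, (a i)⁻¹ * (a j)⁻¹ * Complex.normSq (L i j) : ℝ) : ℂ) := by
    rw [hinv, hKL, congruence_mul_congruence hC, trace_congruence hC,
      trace_diagonal_mul_diagonal_mul L hLh]
  have e2 : (A * (A₀⁻¹ * K * A₀⁻¹ * K * A₀⁻¹)).trace
      = ((∑ i, ∑ j, a i * 1 * Complex.normSq (L i j) : ℝ) : ℂ) := by
    rw [hinv₀, hKL, congruence_mul_congruence hC, congruence_mul_congruence hC, hAC,
      trace_mul_comm, trace_congruence hC, ← trace_diagonal_mul_diagonal_mul L hLh,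
      trace_mul_comm]
    simp [Matrix.mul_assoc]
  rw [e2, e0] at h
  have h := Complex.ofReal_injective h
  have hsw : ∑ i, ∑ j, a j * 1 * Complex.normSq (L i j)
      = ∑ i, ∑ j, a i * 1 * Complex.normSq (L i j) := by
    rw [Finset.sum_comm]
    refine Finset.sum_congr rfl fun i _ => Finset.sum_congr rfl fun j _ => ?_
    rw [← hLh.apply i j, RCLike.star_def, Complex.normSq_conj]
  rw [e0, e1, Complex.ofReal_re, Complex.ofReal_re]
  -- In coordinates where `A₀ = 1` and `A = diag a`, the tangent plane bound applies entry by entry;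
  -- `h` and the symmetry of `|L i j|²` reduce the left side to the value at `A₀`.
  have hle : ∑ i, ∑ j, (3 - a i - a j) * Complex.normSq (L i j)
      ≤ ∑ i, ∑ j, (a i)⁻¹ * (a j)⁻¹ * Complex.normSq (L i j) :=
    Finset.sum_le_sum fun i _ => Finset.sum_le_sum fun j _ =>
      mul_le_mul_of_nonneg_right (three_sub_sub_le_inv_mul_inv (ha i) (ha j))
        (Complex.normSq_nonneg _)
  refine le_trans (le_of_eq ?_) hle
  simp only [sub_mul, Finset.sum_sub_distrib, mul_one, one_mul] at h hsw ⊢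
  rw [hsw, h]
  simp only [← Finset.mul_sum]
  ring

end SimultaneousDiagonalization

/-! ### Pinching to the fibers of a map -/

section Pinching

open Matrix

variable {ι κ : Type*} [DecidableEq κ]

/-- A matrix is block diagonal with respect to the fibers of `π`. -/
def Matrix.IsFiberDiagonal (π : ι → κ) (A : Matrix ι ι ℂ) : Prop :=
  ∀ i j, π i ≠ π j → A i j = 0

/-- The pinching of a matrix to the blocks given by the fibers of `π`. -/
def Matrix.pinch (π : ι → κ) (A : Matrix ι ι ℂ) : Matrix ι ι ℂ :=
  Matrix.of fun i j => if π i = π j then A i j else 0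

theorem Matrix.pinch_isFiberDiagonal (π : ι → κ) (A : Matrix ι ι ℂ) :
    (A.pinch π).IsFiberDiagonal π := fun i j hij => by simp [pinch, hij]

variable [Fintype ι]

theorem Matrix.trace_pinch_mul {π : ι → κ} {A B : Matrix ι ι ℂ} (hB : B.IsFiberDiagonal π) :
    (A.pinch π * B).trace = (A * B).trace := by
  simp only [trace, diag_apply, mul_apply]
  refine Finset.sum_congr rfl fun i _ => Finset.sum_congr rfl fun j _ => ?_
  by_cases hij : π i = π j
  · simp [pinch, hij]
  · rw [hB j i (Ne.symm hij)]; simp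

theorem Matrix.IsFiberDiagonal.trace_mul_eq_zero {π : ι → κ} {A K : Matrix ι ι ℂ}
    (hA : A.IsFiberDiagonal π) (hK : ∀ i j, π i = π j → K i j = 0) : (A * K).trace = 0 := by
  simp only [trace, diag_apply, mul_apply]
  refine Finset.sum_eq_zero fun i _ => Finset.sum_eq_zero fun j _ => ?_
  by_cases hij : π i = π j
  · rw [hK j i hij.symm, mul_zero]
  · rw [hA i j hij, zero_mul]

variable [DecidableEq ι]

/-- Describing block diagonal matrices as a commutant makes closure under products and inverses
immediate. -/
theorem Matrix.isFiberDiagonal_iff_commute {π : ι → κ} {A : Matrix ι ι ℂ} :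
    A.IsFiberDiagonal π ↔ ∀ f : κ → ℂ, A * diagonal (f ∘ π) = diagonal (f ∘ π) * A := by
  constructor
  · intro h f
    ext i j
    rw [mul_diagonal, diagonal_mul]
    by_cases hij : π i = π j
    · simp [hij, mul_comm]
    · simp [h i j hij]
  · intro h i j hij
    have := congrFun (congrFun (h (Pi.single (π i) 1)) i) j
    rw [mul_diagonal, diagonal_mul] at this
    simpa [Pi.single_apply, hij, Ne.symm hij] using this.symm

theorem Matrix.IsFiberDiagonal.mul {π : ι → κ} {A B : Matrix ι ι ℂ} (hA : A.IsFiberDiagonal π)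
    (hB : B.IsFiberDiagonal π) : (A * B).IsFiberDiagonal π := by
  rw [isFiberDiagonal_iff_commute] at *
  intro f
  rw [Matrix.mul_assoc, hB, ← Matrix.mul_assoc, hA, Matrix.mul_assoc]

theorem Matrix.IsFiberDiagonal.inv {π : ι → κ} {A : Matrix ι ι ℂ} (hA : A.IsFiberDiagonal π)
    (hu : IsUnit A.det) : A⁻¹.IsFiberDiagonal π := by
  rw [isFiberDiagonal_iff_commute] at *
  intro f
  calc A⁻¹ * diagonal (f ∘ π) = A⁻¹ * (diagonal (f ∘ π) * A) * A⁻¹ := by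
        rw [Matrix.mul_assoc, Matrix.mul_assoc, mul_nonsing_inv _ hu, Matrix.mul_one]
    _ = diagonal (f ∘ π) * A⁻¹ := by
        rw [← hA, ← Matrix.mul_assoc, nonsing_inv_mul _ hu, Matrix.one_mul]

theorem Matrix.pinch_eq_sum [Fintype κ] (π : ι → κ) (A : Matrix ι ι ℂ) :
    A.pinch π = ∑ k, (diagonal fun i => if π i = k then (1 : ℂ) else 0)ᴴ * A *
      diagonal fun i => if π i = k then (1 : ℂ) else 0 := by
  ext i j
  rw [Matrix.sum_apply]
  simp only [diagonal_conjTranspose, mul_diagonal, diagonal_mul, Pi.star_apply]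
  rw [Finset.sum_eq_single (π i) (fun k _ hk => by simp [Ne.symm hk]) (by simp)]
  by_cases hij : π i = π j
  · simp [pinch, hij]
  · simp [pinch, hij, Ne.symm hij]

theorem Matrix.PosDef.pinch [Fintype κ] (π : ι → κ) {A : Matrix ι ι ℂ} (hA : A.PosDef) :
    (A.pinch π).PosDef := by
  rw [pinch_eq_sum]
  refine PosDef.of_dotProduct_mulVec_pos ?_ fun {x} hx => ?_
  · exact isSelfAdjoint_sum _ fun k _ => isHermitian_conjTranspose_mul_mul _ hA.isHermitian
  · obtain ⟨i, hi⟩ := Function.ne_iff.1 hx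
    have e : ∀ k, star x ⬝ᵥ (((diagonal fun i => if π i = k then (1 : ℂ) else 0)ᴴ * A *
        diagonal fun i => if π i = k then (1 : ℂ) else 0) *ᵥ x)
        = star ((diagonal fun i => if π i = k then (1 : ℂ) else 0) *ᵥ x) ⬝ᵥ
          (A *ᵥ ((diagonal fun i => if π i = k then (1 : ℂ) else 0) *ᵥ x)) := fun k => by
      rw [← mulVec_mulVec, ← mulVec_mulVec, dotProduct_mulVec, star_mulVec]
    rw [sum_mulVec, dotProduct_sum]
    refine Finset.sum_pos' (fun k _ => ?_) ⟨π i, Finset.mem_univ _, ?_⟩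
    · rw [e]; exact hA.posSemidef.dotProduct_mulVec_nonneg _
    · rw [e]
      refine hA.dotProduct_mulVec_pos (Function.ne_iff.2 ⟨i, ?_⟩)
      simpa [mulVec_diagonal] using hi

/-- `A - A.pinch π` is trace-orthogonal to every fiber diagonal matrix, so the first-order term of
the tangent inequality at the pinching vanishes. -/
theorem trace_inv_mul_pinch_le [Fintype κ] {π : ι → κ} {A K : Matrix ι ι ℂ} (hA : A.PosDef)
    (hK : K.IsHermitian) (hKπ : K.IsFiberDiagonal π) :
    ((A.pinch π)⁻¹ * K * (A.pinch π)⁻¹ * K).trace.re ≤ (A⁻¹ * K * A⁻¹ * K).trace.re := by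
  have hA₀ := hA.pinch π
  have hu : IsUnit (A.pinch π).det := (isUnit_iff_isUnit_det _).1 hA₀.isUnit
  have hinv := (pinch_isFiberDiagonal π A).inv hu
  refine trace_inv_mul_mul_inv_mul_ge hA hA₀ hK ?_
  rw [← trace_pinch_mul ((((hinv.mul hKπ).mul hinv).mul hKπ).mul hinv)]
  simp only [Matrix.mul_assoc]
  rw [mul_nonsing_inv_cancel_left _ _ hu, trace_mul_comm]
  simp only [Matrix.mul_assoc]

end Pinching

/-! ### The Fischer-type determinant inequality -/

section BlockDeterminant

open Matrix

variable {n : Type*} [Fintype n] [DecidableEq n]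

theorem det_fromBlocks_diagonal {x y z : n → ℂ} (hx : ∀ i, x i ≠ 0) :
    (fromBlocks (diagonal x) (diagonal y) (diagonal y) (diagonal z)).det
      = ∏ i, (x i * z i - y i ^ 2) := by
  let : Invertible (diagonal x) := ⟨diagonal fun i => (x i)⁻¹,
    by rw [diagonal_mul_diagonal]; simp [hx], by rw [diagonal_mul_diagonal]; simp [hx]⟩
  rw [det_fromBlocks₁₁]
  change _ * det (_ - _ * (diagonal fun i => (x i)⁻¹) * _) = _
  rw [diagonal_mul_diagonal, diagonal_mul_diagonal, diagonal_sub, det_diagonal, det_diagonal,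
    ← Finset.prod_mul_distrib]
  refine Finset.prod_congr rfl fun i _ => ?_
  have := hx i
  field_simp

/-- A Fischer-type determinant inequality for positive definite block matrices with diagonal
off-diagonal blocks. -/
theorem det_fromBlocks_mul_prod_le {X Z : Matrix n n ℂ} {y : n → ℝ}
    (hM : (fromBlocks X (diagonal fun i => (y i : ℂ)) (diagonal fun i => (y i : ℂ)) Z).PosDef) :
    (fromBlocks X (diagonal fun i => (y i : ℂ)) (diagonal fun i => (y i : ℂ)) Z).det.re
        * ∏ i, ((X i i).re * (Z i i).re)
      ≤ X.det.re * Z.det.re * ∏ i, ((X i i).re * (Z i i).re - y i ^ 2) := by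
  set Y : Matrix n n ℂ := diagonal fun i => (y i : ℂ) with hY
  set E : Matrix (n ⊕ n) (n ⊕ n) ℂ := fromBlocks X 0 0 Z with hE
  set K : Matrix (n ⊕ n) (n ⊕ n) ℂ := fromBlocks 0 Y Y 0 with hK
  -- The fibers of `π` pair the two copies of each index. Since `Y` is diagonal, pinching along `π`
  -- fixes `K` and makes `E` diagonal, decoupling the pencil into `2 × 2` blocks.
  set π : n ⊕ n → n := Sum.elim id id with hπ
  have hEK : ∀ t : ℂ, E + t • K = fromBlocks X (t • Y) (t • Y) Z := fun t => by
    rw [hE, hK, fromBlocks_smul, fromBlocks_add]; simp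
  have hX : X.PosDef := hM.submatrix (e := Sum.inl) Sum.inl_injective
  have hZ : Z.PosDef := hM.submatrix (e := Sum.inr) Sum.inr_injective
  have hYh : Yᴴ = Y := by rw [hY, diagonal_conjTranspose]; congr 1; funext i; simp
  have hKh : K.IsHermitian := by
    rw [hK, IsHermitian, fromBlocks_conjTranspose]; simp [hYh]
  have hEpd : E.PosDef := by
    have : E = (fromBlocks X Y Y Z).pinch (Sum.isLeft : n ⊕ n → Bool) := by
      ext (i | i) (j | j) <;> simp [hE, Matrix.pinch]
    rw [this]; exact hM.pinch _
  have hKπ : K.IsFiberDiagonal π := by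
    rintro (i | i) (j | j) hij
    · rfl
    · exact diagonal_apply_ne (fun i => (y i : ℂ)) (show i ≠ j from hij)
    · exact diagonal_apply_ne (fun i => (y i : ℂ)) (show i ≠ j from hij)
    · rfl
  have hEt : ∀ t ∈ Set.Icc (0 : ℝ) 1, (E + (t : ℂ) • K).PosDef := fun t ht => by
    have e : E + (t : ℂ) • K = ((1 - t : ℝ) : ℂ) • E + (t : ℂ) • fromBlocks X Y Y Z := by
      have : fromBlocks X Y Y Z = E + K := by simpa using (hEK 1).symm
      rw [this, smul_add, ← add_assoc, ← add_smul]; simp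
    rw [e]
    rcases ht.1.eq_or_lt with h0 | h0
    · simpa [← h0] using hEpd
    · refine PosDef.posSemidef_add (hEpd.posSemidef.smul ?_) (hM.smul ?_)
      · exact_mod_cast sub_nonneg.2 ht.2
      · exact_mod_cast h0
  have hpin : ∀ t : ℂ, (E + t • K).pinch π = E.pinch π + t • K := fun t => by
    ext i j
    by_cases hij : π i = π j
    · simp [Matrix.pinch, hij]
    · simp [Matrix.pinch, hij, hKπ i j hij]
  have hE₀ := hEpd.pinch π
  obtain ⟨k, hk, hkt⟩ := exists_pencil_spectrum hEpd hKh
  obtain ⟨k₀, hk₀, hkt₀⟩ := exists_pencil_spectrum hE₀ hKh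
  have hKl : ∀ i j : n ⊕ n, i.isLeft = j.isLeft → K i j = 0 := by
    rintro (i | i) (j | j) hij
    · rfl
    · simp at hij
    · simp at hij
    · rfl
  have hEl : E.IsFiberDiagonal (Sum.isLeft : n ⊕ n → Bool) := by
    rintro (i | i) (j | j) hij
    · simp at hij
    · rfl
    · rfl
    · simp at hij
  have hE₀l : (E.pinch π).IsFiberDiagonal (Sum.isLeft : n ⊕ n → Bool) := fun i j hij => by
    simp [Matrix.pinch, hEl i j hij]
  -- The first-order term `tr (E⁻¹K)` vanishes: `E⁻¹` is block diagonal and `K` is block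
  -- off-diagonal. The same holds after pinching.
  have s0 : ∑ i, k i = 0 := by
    rw [(hEl.inv ((isUnit_iff_isUnit_det _).1 hEpd.isUnit)).trace_mul_eq_zero hKl] at hk
    exact_mod_cast hk.symm
  have s0' : ∑ i, k₀ i = 0 := by
    rw [(hE₀l.inv ((isUnit_iff_isUnit_det _).1 hE₀.isUnit)).trace_mul_eq_zero hKl] at hk₀
    exact_mod_cast hk₀.symm
  have hE₀t : ∀ t ∈ Set.Icc (0 : ℝ) 1, (E.pinch π + (t : ℂ) • K).PosDef := fun t ht => by
    rw [← hpin]; exact (hEt t ht).pinch π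
  have h1 : (1 : ℝ) ∈ Set.Icc (0 : ℝ) 1 := Set.right_mem_Icc.2 zero_le_one
  have hprod := prod_one_add_le_of_sum_sq_div_le
    (fun i => by simpa using ((hkt 1).2 (hEt 1 h1)).1 i)
    (fun i => by simpa using ((hkt₀ 1).2 (hE₀t 1 h1)).1 i) s0 s0' (fun t ht => by
      have := trace_inv_mul_pinch_le (hEt t ht) hKh hKπ
      rw [hpin, ((hkt t).2 (hEt t ht)).2, ((hkt₀ t).2 (hE₀t t ht)).2] at this
      exact_mod_cast this)
  have d1 := (hkt 1).1
  have d2 := (hkt₀ 1).1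
  have hdE : E.det = X.det * Z.det := by rw [hE, det_fromBlocks_zero₂₁]
  have hpinE : E.pinch π = fromBlocks (diagonal fun i => ((X i i).re : ℂ)) 0 0
      (diagonal fun i => ((Z i i).re : ℂ)) := by
    ext (i | i) (j | j)
    · by_cases h : i = j
      · subst h
        simpa [Matrix.pinch, hπ, hE] using (hX.isHermitian.coe_re_apply_self i).symm
      · simp [Matrix.pinch, hπ, hE, h]
    · simp only [Matrix.pinch, hE, of_apply, fromBlocks_apply₁₂, Matrix.zero_apply, ite_self]
    · simp only [Matrix.pinch, hE, of_apply, fromBlocks_apply₂₁, Matrix.zero_apply, ite_self]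
    · by_cases h : i = j
      · subst h
        simpa [Matrix.pinch, hπ, hE] using (hZ.isHermitian.coe_re_apply_self i).symm
      · simp [Matrix.pinch, hπ, hE, h]
  have hxpos : ∀ i, 0 < (X i i).re := fun i => (Complex.pos_iff.1 hX.diag_pos).1
  have hzpos : ∀ i, 0 < (Z i i).re := fun i => (Complex.pos_iff.1 hZ.diag_pos).1
  have hdE₀ : (E.pinch π).det = ((∏ i, ((X i i).re * (Z i i).re) : ℝ) : ℂ) := by
    rw [hpinE, det_fromBlocks_zero₂₁, det_diagonal, det_diagonal, ← Finset.prod_mul_distrib]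
    push_cast; rfl
  have hdM₀ : (E.pinch π + ((1 : ℝ) : ℂ) • K).det
      = ((∏ i, ((X i i).re * (Z i i).re - y i ^ 2) : ℝ) : ℂ) := by
    rw [hpinE, hK, Complex.ofReal_one, one_smul, fromBlocks_add]
    simp only [add_zero, zero_add]
    rw [hY, det_fromBlocks_diagonal fun i => by exact_mod_cast (hxpos i).ne']
    push_cast; rfl
  rw [hEK, hdE] at d1
  rw [hdM₀, hdE₀] at d2
  simp only [Complex.ofReal_one, one_smul, one_mul] at d1 d2
  have d2 : ∏ i, ((X i i).re * (Z i i).re - y i ^ 2)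
      = (∏ i, ((X i i).re * (Z i i).re)) * ∏ i, (1 + k₀ i) := by exact_mod_cast d2
  have hXd : 0 < X.det := hX.det_pos
  have hZd : 0 < Z.det := hZ.det_pos
  have hXr : 0 < X.det.re := (Complex.pos_iff.1 hXd).1
  have hZr : 0 < Z.det.re := (Complex.pos_iff.1 hZd).1
  have hXi : X.det.im = 0 := (Complex.pos_iff.1 hXd).2.symm
  have hZi : Z.det.im = 0 := (Complex.pos_iff.1 hZd).2.symm
  have d1r : (fromBlocks X Y Y Z).det.re = X.det.re * Z.det.re * ∏ i, (1 + k i) := by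
    rw [d1, Complex.re_mul_ofReal, Complex.mul_re, hXi, hZi]; ring
  rw [d1r, d2]
  have hP : 0 < ∏ i, ((X i i).re * (Z i i).re) :=
    Finset.prod_pos fun i _ => mul_pos (hxpos i) (hzpos i)
  have := mul_le_mul_of_nonneg_left hprod (mul_pos (mul_pos hXr hZr) hP).le
  linarith

end BlockDeterminant

/-! ### Singular value decomposition -/

section SingularValueDecomposition

open Matrix

variable {𝕜 : Type*} [RCLike 𝕜] {ι : Type*} [Fintype ι] [DecidableEq ι]

/-- Singular value decomposition of a square matrix. -/
theorem Matrix.exists_svd (A : Matrix ι ι 𝕜) :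
    ∃ (U V : Matrix ι ι 𝕜) (σ : ι → ℝ), Uᴴ * U = 1 ∧ Vᴴ * V = 1 ∧ (∀ i, 0 ≤ σ i) ∧
      A = U * diagonal (fun i => (σ i : 𝕜)) * Vᴴ := by
  have hH := isHermitian_conjTranspose_mul_self A
  obtain ⟨V, hV1, hV2, hV⟩ := hH.exists_unitary_diagonal
  have hμ := eigenvalues_conjTranspose_mul_self_nonneg A
  generalize hH.eigenvalues = μ at hV hμ
  set B := A * V with hB
  have hBB : Bᴴ * B = diagonal (fun i => (μ i : 𝕜)) := by
    calc Bᴴ * B = Vᴴ * (Aᴴ * A) * V := by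
          rw [hB, conjTranspose_mul]; simp only [Matrix.mul_assoc]
      _ = (Vᴴ * V) * diagonal (fun i => (μ i : 𝕜)) * (Vᴴ * V) := by
          rw [hV]; simp only [Matrix.mul_assoc]
      _ = _ := by rw [hV1, Matrix.one_mul, Matrix.mul_one]
  set σ : ι → ℝ := fun i => √(μ i) with hσ
  have hσ2 : ∀ i, σ i ^ 2 = μ i := fun i => Real.sq_sqrt (hμ i)
  -- The left singular vectors `A v_j / σ_j`. Those with `σ j ≠ 0` are orthonormal and get extended
  -- to a basis; the remaining columns of `A * V` are zero, so any extension works.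
  set u : ι → EuclideanSpace 𝕜 ι := fun j => WithLp.toLp 2 fun i => ((σ j)⁻¹ : 𝕜) * B i j with hu
  have hinner : ∀ j k, inner 𝕜 (u j) (u k) = ((σ j)⁻¹ : 𝕜) * ((σ k)⁻¹ : 𝕜) * (Bᴴ * B) j k := by
    intro j k
    simp only [hu, PiLp.inner_apply, RCLike.inner_apply, mul_apply, conjTranspose_apply,
      Finset.mul_sum, map_mul, map_inv₀, RCLike.conj_ofReal, RCLike.star_def]
    refine Finset.sum_congr rfl fun i _ => ?_
    ring
  have hon : Orthonormal 𝕜 ({j | σ j ≠ 0}.domRestrict u) := by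
    rw [orthonormal_iff_ite]
    rintro ⟨j, hj⟩ ⟨k, hk⟩
    simp only [Set.domRestrict_apply, hinner, hBB, Subtype.mk.injEq]
    by_cases hjk : j = k
    · subst hjk
      have hj : σ j ≠ 0 := hj
      have hj' : (σ j : 𝕜) ≠ 0 := by exact_mod_cast hj
      rw [if_pos rfl, diagonal_apply_eq, ← hσ2]
      push_cast
      field_simp
    · rw [if_neg hjk, diagonal_apply_ne _ hjk, mul_zero]
  obtain ⟨b, hb⟩ := hon.exists_orthonormalBasis_extension_of_card_eq (by simp)
  refine ⟨Matrix.of fun i j => b j i, V, σ, ?_, hV1, fun i => Real.sqrt_nonneg _, ?_⟩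
  · ext j k
    have := orthonormal_iff_ite.1 b.orthonormal j k
    rw [PiLp.inner_apply] at this
    simp only [mul_apply, conjTranspose_apply, of_apply, one_apply, RCLike.star_def]
    rw [← this]
    refine Finset.sum_congr rfl fun i _ => ?_
    rw [RCLike.inner_apply, mul_comm]
  · have hBU : B = (Matrix.of fun i j => b j i) * diagonal (fun i => (σ i : 𝕜)) := by
      ext i j
      rw [mul_diagonal, of_apply]
      by_cases hj : σ j = 0
      · have h0 : (Bᴴ * B) j j = 0 := by
          rw [hBB, diagonal_apply_eq, ← hσ2, hj]; simp
        rw [hj, RCLike.ofReal_zero, mul_zero]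
        rw [mul_apply] at h0
        simp only [conjTranspose_apply, RCLike.star_def, RCLike.conj_mul] at h0
        have h1 : ∑ i, ‖B i j‖ ^ 2 = 0 := by exact_mod_cast h0
        have := (Finset.sum_eq_zero_iff_of_nonneg fun i _ => by positivity).1 h1 i
          (Finset.mem_univ i)
        simpa using this
      · have hj' : (σ j : 𝕜) ≠ 0 := by exact_mod_cast hj
        rw [hb j hj]
        simp only [hu]
        field_simp
    rw [← hBU, hB, Matrix.mul_assoc, hV2, Matrix.mul_one]

end SingularValueDecomposition

/-! ### Schatten norms in terms of singular values and eigenvalues -/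

section SchattenNorm

open Matrix Polynomial

variable {𝕜 : Type*} [RCLike 𝕜] {ι : Type*} [Fintype ι] [DecidableEq ι]

theorem Matrix.IsHermitian.trace_cfc {A : Matrix ι ι 𝕜} (hA : A.IsHermitian) (f : ℝ → ℝ) :
    (cfc f A).trace = ((∑ i, f (hA.eigenvalues i) : ℝ) : 𝕜) := by
  rw [hA.cfc_eq, IsHermitian.cfc, Unitary.conjStarAlgAut_apply, trace_mul_comm,
    ← Matrix.mul_assoc, Unitary.coe_star_mul_self, Matrix.one_mul, trace_diagonal]
  simp

theorem roots_prod_X_sub_C_ofReal {κ : Type*} [Fintype κ] (d : κ → ℝ) :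
    (∏ i, (X - C (d i : 𝕜))).roots = Finset.univ.val.map fun i => (d i : 𝕜) := by
  rw [← roots_multiset_prod_X_sub_C (Finset.univ.val.map fun i => (d i : 𝕜)), Multiset.map_map]
  rfl

/-- Spectral sums depend only on the multiset of roots, so any factorization, over any index type,
computes them without matching orderings. -/
theorem Matrix.IsHermitian.sum_eigenvalues_of_charpoly {A : Matrix ι ι 𝕜} (hA : A.IsHermitian)
    {κ : Type*} [Fintype κ] {d : κ → ℝ} (h : A.charpoly = ∏ i, (X - C (d i : 𝕜))) (f : ℝ → ℝ) :
    ∑ i, f (hA.eigenvalues i) = ∑ i, f (d i) := by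
  have h1 := hA.roots_charpoly_eq_eigenvalues
  rw [h, roots_prod_X_sub_C_ofReal] at h1
  have h2 := congrArg (fun s : Multiset 𝕜 => (s.map fun z => f (RCLike.re z)).sum) h1
  simpa [Multiset.map_map, Function.comp_def] using h2.symm

theorem charpoly_mul_diagonal_mul {U V : Matrix ι ι 𝕜} (h : V * U = 1) (d : ι → 𝕜) :
    (U * diagonal d * V).charpoly = ∏ i, (X - C (d i)) := by
  rw [charpoly_mul_comm, ← Matrix.mul_assoc, h, Matrix.one_mul, charpoly_diagonal]

theorem schattenNorm_svd {U V : Matrix ι ι 𝕜} {σ : ι → ℝ} (hU : Uᴴ * U = 1) (hV : Vᴴ * V = 1)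
    (hσ : ∀ i, 0 ≤ σ i) {p : ℝ≥0∞} (hp : p ≠ ∞) :
    schattenNorm p (U * diagonal (fun i => (σ i : 𝕜)) * Vᴴ)
      = (∑ i, σ i ^ p.toReal) ^ (1 / p.toReal) := by
  set A := U * diagonal (fun i => (σ i : 𝕜)) * Vᴴ with hA
  have hAA : Aᴴ * A = V * diagonal (fun i => ((σ i ^ 2 : ℝ) : 𝕜)) * Vᴴ := by
    have : (diagonal fun i => ((σ i ^ 2 : ℝ) : 𝕜))
        = (diagonal (fun i => (σ i : 𝕜)))ᴴ * (Uᴴ * U) * diagonal (fun i => (σ i : 𝕜)) := by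
      rw [hU, Matrix.mul_one, diagonal_conjTranspose, diagonal_mul_diagonal]
      congr 1; funext i; simp [sq]
    rw [this, hA, conjTranspose_mul, conjTranspose_mul, conjTranspose_conjTranspose]
    simp only [Matrix.mul_assoc]
  have hH := isHermitian_conjTranspose_mul_self A
  rw [schattenNorm, if_neg hp, hH.trace_cfc, RCLike.ofReal_re,
    hH.sum_eigenvalues_of_charpoly (d := fun i => σ i ^ 2)
      (by rw [hAA, charpoly_mul_diagonal_mul hV]) (fun x => x ^ (p.toReal / 2))]
  congr 1
  refine Finset.sum_congr rfl fun i _ => ?_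
  rw [← Real.rpow_natCast, ← Real.rpow_mul (hσ i)]
  congr 1
  push_cast
  ring

open scoped Matrix.Norms.L2Operator in
theorem schattenNorm_top_svd {U V : Matrix ι ι 𝕜} (hU : Uᴴ * U = 1) (hV : Vᴴ * V = 1)
    (σ : ι → ℝ) :
    schattenNorm ∞ (U * diagonal (fun i => (σ i : 𝕜)) * Vᴴ) = ‖fun i => (σ i : 𝕜)‖ := by
  have hU' : U ∈ unitary (Matrix ι ι 𝕜) := ⟨hU, mul_eq_one_comm.1 hU⟩
  have hV' : Vᴴ ∈ unitary (Matrix ι ι 𝕜) :=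
    ⟨by simpa [star_eq_conjTranspose] using mul_eq_one_comm.1 hV,
      by simpa [star_eq_conjTranspose] using hV⟩
  rw [schattenNorm, if_pos rfl, l2_opNorm_toEuclideanCLM, CStarRing.norm_mul_mem_unitary _ hV',
    CStarRing.norm_mem_unitary_mul _ hU', l2_opNorm_diagonal]

theorem schattenNorm_of_charpoly {A : Matrix ι ι 𝕜} (hA : A.IsHermitian)
    {κ : Type*} [Fintype κ] {d : κ → ℝ} (hd : ∀ i, 0 ≤ d i)
    (h : A.charpoly = ∏ i, (X - C (d i : 𝕜))) {p : ℝ≥0∞} (hp : p ≠ ∞) :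
    schattenNorm p A = (∑ i, d i ^ p.toReal) ^ (1 / p.toReal) := by
  obtain ⟨U, hU1, hU2, hU⟩ := hA.exists_unitary_diagonal
  have hnn : ∀ i, 0 ≤ hA.eigenvalues i := fun i => by
    have h1 := hA.roots_charpoly_eq_eigenvalues
    rw [h, roots_prod_X_sub_C_ofReal] at h1
    have h2 : (hA.eigenvalues i : 𝕜) ∈ Multiset.map (fun i => (hA.eigenvalues i : 𝕜))
      Finset.univ.val := Multiset.mem_map.2 ⟨i, Finset.mem_univ i, rfl⟩
    have h3 := h1 ▸ h2
    obtain ⟨j, -, hj⟩ := Multiset.mem_map.1 h3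
    have : d j = hA.eigenvalues i := by exact_mod_cast hj
    rw [← this]; exact hd j
  rw [← hA.sum_eigenvalues_of_charpoly h (fun x => x ^ p.toReal)]
  conv_lhs => rw [hU]
  exact schattenNorm_svd hU1 hU1 hnn hp

end SchattenNorm

/-! ### From block matrices to `2 × 2` excesses -/

section PowerSums

open Matrix

variable {ι : Type*} [Fintype ι] [DecidableEq ι]

theorem Matrix.IsHermitian.det_add_smul_one {A : Matrix ι ι ℂ} (hA : A.IsHermitian) (s : ℝ) :
    (A + (s : ℂ) • (1 : Matrix ι ι ℂ)).det = ((∏ i, (hA.eigenvalues i + s) : ℝ) : ℂ) := by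
  obtain ⟨U, hU1, hU2, hU⟩ := hA.exists_unitary_diagonal
  have e : A + (s : ℂ) • (1 : Matrix ι ι ℂ)
      = U * diagonal (fun i => ((hA.eigenvalues i + s : ℝ) : ℂ)) * Uᴴ := by
    have : (diagonal (fun i => ((hA.eigenvalues i + s : ℝ) : ℂ)) : Matrix ι ι ℂ)
        = diagonal (fun i => (hA.eigenvalues i : ℂ)) + (s : ℂ) • 1 := by
      rw [← diagonal_one, ← diagonal_smul, diagonal_add]
      congr 1; funext i; simp
    rw [this, Matrix.mul_add, Matrix.add_mul, Matrix.mul_smul, Matrix.mul_one, Matrix.smul_mul,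
      hU2]
    exact congrArg (· + (s : ℂ) • (1 : Matrix ι ι ℂ)) hU
  rw [e, det_mul_comm, ← Matrix.mul_assoc, hU1, Matrix.one_mul, det_diagonal]
  push_cast; rfl

/-- Schur's majorization: the diagonal is the image of the spectrum under the doubly stochastic
matrix `|U i k|²`, so Jensen applies row by row. -/
theorem Matrix.PosSemidef.sum_rpow_diag_le {A : Matrix ι ι ℂ} (hA : A.PosSemidef) {p : ℝ}
    (hp : 1 ≤ p) : ∑ i, (A i i).re ^ p ≤ ∑ i, hA.isHermitian.eigenvalues i ^ p := by
  obtain ⟨U, hU1, hU2, hU⟩ := hA.isHermitian.exists_unitary_diagonal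
  have hnn := hA.eigenvalues_nonneg
  generalize hA.isHermitian.eigenvalues = e at hU hnn
  have hrow : ∀ i, ∑ k, Complex.normSq (U i k) = 1 := fun i => by
    have := congrFun (congrFun hU2 i) i
    rw [mul_apply, one_apply_eq] at this
    simp only [conjTranspose_apply, RCLike.star_def, Complex.mul_conj] at this
    exact_mod_cast this
  have hcol : ∀ k, ∑ i, Complex.normSq (U i k) = 1 := fun k => by
    have := congrFun (congrFun hU1 k) k
    rw [mul_apply, one_apply_eq] at this
    simp only [conjTranspose_apply, RCLike.star_def, mul_comm (starRingEnd ℂ _),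
      Complex.mul_conj] at this
    exact_mod_cast this
  have hdiag : ∀ i, (A i i).re = ∑ k, Complex.normSq (U i k) * e k := fun i => by
    have : A i i = ((∑ k, Complex.normSq (U i k) * e k : ℝ) : ℂ) := by
      rw [hU, mul_apply]
      push_cast
      refine Finset.sum_congr rfl fun k _ => ?_
      rw [mul_diagonal, conjTranspose_apply, RCLike.star_def, ← Complex.mul_conj]
      simp only [Complex.coe_algebraMap]
      ring
    rw [this, Complex.ofReal_re]
  calc ∑ i, (A i i).re ^ p ≤ ∑ i, ∑ k, Complex.normSq (U i k) * e k ^ p := by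
        refine Finset.sum_le_sum fun i _ => ?_
        rw [hdiag]
        exact (convexOn_rpow hp).map_sum_le (fun k _ => Complex.normSq_nonneg _) (hrow i)
          fun k _ => hnn k
    _ = ∑ k, e k ^ p := by
        rw [Finset.sum_comm]
        simp only [← Finset.sum_mul, hcol, one_mul]

theorem Matrix.IsHermitian.sum_eigenvalues_eq_sum_re_diag {A : Matrix ι ι ℂ}
    (hA : A.IsHermitian) : ∑ i, hA.eigenvalues i = ∑ i, (A i i).re := by
  have := congrArg Complex.re hA.trace_eq_sum_eigenvalues
  simpa [trace] using this.symm

/-- The excess of the block matrix dominates the sum of the `2 × 2` excesses. Moving negative terms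
across gives two families with equal sums; adding `s` to `M` leaves `y` unchanged, so their shifted
products are compared by the Fischer-type inequality for `M + s`. -/
theorem sum_rpow_eigenvalues_block_le {X Z : Matrix ι ι ℂ} {y : ι → ℝ}
    (hM : (fromBlocks X (diagonal fun i => (y i : ℂ)) (diagonal fun i => (y i : ℂ)) Z).PosSemidef)
    (hX : X.PosSemidef) (hZ : Z.PosSemidef)
    (hy : ∀ i, y i ^ 2 ≤ (X i i).re * (Z i i).re) {p : ℝ} (h1 : 1 ≤ p) (h2 : p ≤ 2) :
    ∑ i, hX.isHermitian.eigenvalues i ^ p + ∑ i, hZ.isHermitian.eigenvalues i ^ p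
        + ∑ i, eigPowSum p (X i i).re (y i) (Z i i).re
      ≤ ∑ i, hM.isHermitian.eigenvalues i ^ p + (∑ i, (X i i).re ^ p + ∑ i, (Z i i).re ^ p) := by
  have hx : ∀ i, 0 ≤ (X i i).re := fun i => (Complex.nonneg_iff.1 hX.diag_nonneg).1
  have hz : ∀ i, 0 ≤ (Z i i).re := fun i => (Complex.nonneg_iff.1 hZ.diag_nonneg).1
  have sM := hM.isHermitian.sum_eigenvalues_eq_sum_re_diag
  simp only [Fintype.sum_sum_type, fromBlocks_apply₁₁, fromBlocks_apply₂₂] at sM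
  have sX := hX.isHermitian.sum_eigenvalues_eq_sum_re_diag
  have sZ := hZ.isHermitian.sum_eigenvalues_eq_sum_re_diag
  have sm : ∑ i, eigHi (X i i).re (y i) (Z i i).re + ∑ i, eigLo (X i i).re (y i) (Z i i).re
      = ∑ i, (X i i).re + ∑ i, (Z i i).re := by
    rw [← Finset.sum_add_distrib, ← Finset.sum_add_distrib]
    simp only [eigHi_add_eigLo]
  have key := sum_rpow_le_of_prod_add_le (p := p)
    (a := Sum.elim hM.isHermitian.eigenvalues
      (Sum.elim (fun i => (X i i).re) (fun i => (Z i i).re)))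
    (b := Sum.elim (Sum.elim hX.isHermitian.eigenvalues hZ.isHermitian.eigenvalues)
      (Sum.elim (fun i => eigHi (X i i).re (y i) (Z i i).re)
        (fun i => eigLo (X i i).re (y i) (Z i i).re)))
    (by rintro (i | i | i)
        exacts [hM.eigenvalues_nonneg i, hx i, hz i])
    (by rintro ((i | i) | i | i)
        exacts [hX.eigenvalues_nonneg i, hZ.eigenvalues_nonneg i, eigHi_nonneg _ (hx i) (hz i),
          eigLo_nonneg (hx i) (hz i) (hy i)])
    rfl
    (by
      simp only [Fintype.sum_sum_type, Sum.elim_inl, Sum.elim_inr]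
      linarith)
    (fun s hs => by
      simp only [Fintype.prod_sum_type, Sum.elim_inl, Sum.elim_inr]
      have hs1 : ∀ {κ : Type _} [Fintype κ] [DecidableEq κ], ((s : ℂ) • (1 : Matrix κ κ ℂ)).PosDef :=
        PosDef.one.smul (by exact_mod_cast hs)
      have e : fromBlocks X (diagonal fun i => (y i : ℂ)) (diagonal fun i => (y i : ℂ)) Z
          + (s : ℂ) • (1 : Matrix (ι ⊕ ι) (ι ⊕ ι) ℂ)
          = fromBlocks (X + (s : ℂ) • (1 : Matrix ι ι ℂ)) (diagonal fun i => (y i : ℂ))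
            (diagonal fun i => (y i : ℂ)) (Z + (s : ℂ) • (1 : Matrix ι ι ℂ)) := by
        rw [← fromBlocks_one, fromBlocks_smul, fromBlocks_add]; simp
      have hpd := PosDef.posSemidef_add hM hs1
      rw [e] at hpd
      have := det_fromBlocks_mul_prod_le hpd
      rw [← e, hM.isHermitian.det_add_smul_one, hX.isHermitian.det_add_smul_one,
        hZ.isHermitian.det_add_smul_one] at this
      have hxz : ∀ i, (X i i + s).re * (Z i i + s).re - y i ^ 2
          = (eigHi (X i i).re (y i) (Z i i).re + s) * (eigLo (X i i).re (y i) (Z i i).re + s) :=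
        fun i => by rw [eigHi_add_mul_eigLo_add]; simp
      simp only [Matrix.add_apply, Matrix.smul_apply, one_apply_eq, smul_eq_mul, mul_one, hxz,
        Finset.prod_mul_distrib, Fintype.prod_sum_type, Complex.ofReal_re] at this
      simpa using this) h1 h2
  simp only [Fintype.sum_sum_type, Sum.elim_inl, Sum.elim_inr] at key
  unfold eigPowSum
  rw [Finset.sum_add_distrib, Fintype.sum_sum_type]
  linarith

end PowerSums

/-! ### Hölder's inequality for Schatten norms -/

section Holder

open Matrix

variable {𝕜 : Type*} [RCLike 𝕜] {ι : Type*} [Fintype ι] [DecidableEq ι]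

theorem Matrix.sum_norm_sq_row_of_unitary {P : Matrix ι ι 𝕜} (h : P * Pᴴ = 1) (i : ι) :
    ∑ j, ‖P i j‖ ^ 2 = 1 := by
  have := congrFun (congrFun h i) i
  rw [mul_apply, one_apply_eq] at this
  simp only [conjTranspose_apply, RCLike.star_def, RCLike.mul_conj] at this
  exact_mod_cast this

theorem Matrix.sum_norm_sq_col_of_unitary {P : Matrix ι ι 𝕜} (h : Pᴴ * P = 1) (j : ι) :
    ∑ i, ‖P i j‖ ^ 2 = 1 := by
  have := sum_norm_sq_row_of_unitary (P := Pᴴ) (by rwa [conjTranspose_conjTranspose]) j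
  simpa using this

/-- The trace of a product is bounded by the singular values of the factors, coupled by a doubly
substochastic matrix. -/
theorem exists_re_trace_mul_le (A B : Matrix ι ι 𝕜) :
    ∃ (a b : ι → ℝ) (w : ι → ι → ℝ), (∀ i, 0 ≤ a i) ∧ (∀ i, 0 ≤ b i) ∧ (∀ i j, 0 ≤ w i j) ∧
      (∀ i, ∑ j, w i j ≤ 1) ∧ (∀ j, ∑ i, w i j ≤ 1) ∧
      RCLike.re (A * B).trace ≤ ∑ i, ∑ j, a i * b j * w i j ∧
      (∀ p : ℝ≥0∞, p ≠ ∞ → schattenNorm p A = (∑ i, a i ^ p.toReal) ^ (1 / p.toReal)) ∧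
      (∀ p : ℝ≥0∞, p ≠ ∞ → schattenNorm p B = (∑ i, b i ^ p.toReal) ^ (1 / p.toReal)) ∧
      ∀ i, a i ≤ schattenNorm ∞ A := by
  obtain ⟨U, V, a, hU, hV, ha, hA⟩ := A.exists_svd
  obtain ⟨W, T, b, hW, hT, hb, hB⟩ := B.exists_svd
  have hU' := mul_eq_one_comm.1 hU
  have hV' := mul_eq_one_comm.1 hV
  have hW' := mul_eq_one_comm.1 hW
  have hT' := mul_eq_one_comm.1 hT
  have uni : ∀ {S R : Matrix ι ι 𝕜}, S * Sᴴ = 1 → Rᴴ * R = 1 → (Sᴴ * R)ᴴ * (Sᴴ * R) = 1 :=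
    fun {S R} hS hR => by
      rw [conjTranspose_mul, conjTranspose_conjTranspose, Matrix.mul_assoc, ← Matrix.mul_assoc S,
        hS, Matrix.one_mul, hR]
  set P := Vᴴ * W with hP
  set Q := Tᴴ * U with hQ
  have hP1 : Pᴴ * P = 1 := uni hV' hW
  have hQ1 : Qᴴ * Q = 1 := uni hT' hU
  have hP2 := mul_eq_one_comm.1 hP1
  have hQ2 := mul_eq_one_comm.1 hQ1
  -- The coupling is `|P i j| |Q j i|`. Rows and columns of a unitary have unit `ℓ²` norm, so
  -- averaging the two squares bounds all its marginals by `1`.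
  have amgm : ∀ i j, ‖P i j‖ * ‖Q j i‖ ≤ (‖P i j‖ ^ 2 + ‖Q j i‖ ^ 2) / 2 := fun i j => by
    nlinarith [sq_nonneg (‖P i j‖ - ‖Q j i‖)]
  refine ⟨a, b, fun i j => ‖P i j‖ * ‖Q j i‖, ha, hb, fun i j => by positivity, fun i => ?_,
    fun j => ?_, ?_, fun p hp => ?_, fun p hp => ?_, fun i => ?_⟩
  · refine (Finset.sum_le_sum fun j _ => amgm i j).trans ?_
    rw [← Finset.sum_div, Finset.sum_add_distrib, sum_norm_sq_row_of_unitary hP2,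
      sum_norm_sq_col_of_unitary hQ1]
    norm_num
  · refine (Finset.sum_le_sum fun i _ => amgm i j).trans ?_
    rw [← Finset.sum_div, Finset.sum_add_distrib, sum_norm_sq_col_of_unitary hP1,
      sum_norm_sq_row_of_unitary hQ2]
    norm_num
  · have e : (A * B).trace = ∑ i, ∑ j, (a i : 𝕜) * P i j * (b j : 𝕜) * Q j i := by
      calc (A * B).trace = (U * (diagonal (fun i => (a i : 𝕜)) * P *
            diagonal (fun i => (b i : 𝕜)) * Tᴴ)).trace := by
            rw [hA, hB, hP]; simp only [Matrix.mul_assoc]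
        _ = (diagonal (fun i => (a i : 𝕜)) * P * diagonal (fun i => (b i : 𝕜)) * Q).trace := by
            rw [trace_mul_comm, hQ]; simp only [Matrix.mul_assoc]
        _ = _ := by
            simp only [trace, diag_apply, mul_apply (M := _ * _) (N := Q), mul_diagonal,
              diagonal_mul]
    rw [e]
    refine (RCLike.re_le_norm _).trans ((norm_sum_le _ _).trans
      (Finset.sum_le_sum fun i _ => (norm_sum_le _ _).trans (Finset.sum_le_sum fun j _ => ?_)))
    simp only [norm_mul, RCLike.norm_ofReal, abs_of_nonneg (ha i), abs_of_nonneg (hb j)]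
    exact le_of_eq (by ring)
  · rw [hA, schattenNorm_svd hU hV ha hp]
  · rw [hB, schattenNorm_svd hW hT hb hp]
  · rw [hA, schattenNorm_top_svd hU hV]
    have := norm_le_pi_norm (fun i => (a i : 𝕜)) i
    simpa [abs_of_nonneg (ha i)] using this

/-- Hölder's inequality for Schatten norms. -/
theorem re_trace_mul_le_schattenNorm_mul (A B : Matrix ι ι 𝕜) {p q : ℝ≥0∞} (hp : p ≠ ∞)
    (hq : q ≠ ∞) (hpq : p.toReal.HolderConjugate q.toReal) :
    RCLike.re (A * B).trace ≤ schattenNorm p A * schattenNorm q B := by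
  obtain ⟨a, b, w, ha, hb, hw, hrow, hcol, htr, hA, hB, -⟩ := exists_re_trace_mul_le A B
  rw [hA p hp, hB q hq]
  generalize p.toReal = r at *
  generalize q.toReal = t at *
  have hr : 0 < r := hpq.pos
  have ht : 0 < t := hpq.symm.pos
  refine htr.trans ?_
  -- Scalar Hölder on index pairs, with the weight split as `w = w^(1/r) * w^(1/t)`.
  have h := Real.inner_le_Lp_mul_Lq_of_nonneg (Finset.univ : Finset (ι × ι)) hpq
    (f := fun x => a x.1 * w x.1 x.2 ^ (1 / r)) (g := fun x => b x.2 * w x.1 x.2 ^ (1 / t))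
    (fun x _ => mul_nonneg (ha _) (Real.rpow_nonneg (hw _ _) _))
    (fun x _ => mul_nonneg (hb _) (Real.rpow_nonneg (hw _ _) _))
  simp only [Fintype.sum_prod_type] at h
  have e1 : ∀ i j, a i * w i j ^ (1 / r) * (b j * w i j ^ (1 / t)) = a i * b j * w i j :=
    fun i j => by
      have : w i j ^ (1 / r) * w i j ^ (1 / t) = w i j := by
        rw [← Real.rpow_add_of_nonneg (hw i j) (by positivity) (by positivity), one_div, one_div,
          hpq.inv_add_inv_eq_one, Real.rpow_one]
      calc _ = a i * b j * (w i j ^ (1 / r) * w i j ^ (1 / t)) := by ring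
        _ = _ := by rw [this]
  have e2 : ∀ i j, (a i * w i j ^ (1 / r)) ^ r = a i ^ r * w i j := fun i j => by
    rw [Real.mul_rpow (ha i) (Real.rpow_nonneg (hw i j) _), one_div,
      Real.rpow_inv_rpow (hw i j) hr.ne']
  have e3 : ∀ i j, (b j * w i j ^ (1 / t)) ^ t = b j ^ t * w i j := fun i j => by
    rw [Real.mul_rpow (hb j) (Real.rpow_nonneg (hw i j) _), one_div,
      Real.rpow_inv_rpow (hw i j) ht.ne']
  simp only [e1, e2, e3] at h
  refine h.trans ?_
  have l1 : ∑ i, ∑ j, a i ^ r * w i j ≤ ∑ i, a i ^ r := Finset.sum_le_sum fun i _ => by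
    rw [← Finset.mul_sum]
    exact mul_le_of_le_one_right (Real.rpow_nonneg (ha i) r) (hrow i)
  have l2 : ∑ i, ∑ j, b j ^ t * w i j ≤ ∑ j, b j ^ t := by
    rw [Finset.sum_comm]
    refine Finset.sum_le_sum fun j _ => ?_
    rw [← Finset.mul_sum]
    exact mul_le_of_le_one_right (Real.rpow_nonneg (hb j) t) (hcol j)
  have n1 : 0 ≤ ∑ i, ∑ j, a i ^ r * w i j := Finset.sum_nonneg fun i _ => Finset.sum_nonneg
    fun j _ => mul_nonneg (Real.rpow_nonneg (ha i) r) (hw i j)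
  have n2 : 0 ≤ ∑ i, ∑ j, b j ^ t * w i j := Finset.sum_nonneg fun i _ => Finset.sum_nonneg
    fun j _ => mul_nonneg (Real.rpow_nonneg (hb j) t) (hw i j)
  exact mul_le_mul (Real.rpow_le_rpow n1 l1 (by positivity))
    (Real.rpow_le_rpow n2 l2 (by positivity)) (Real.rpow_nonneg n2 _)
    (Real.rpow_nonneg (n1.trans l1) _)

theorem re_trace_mul_le_schattenNorm_top_mul (A B : Matrix ι ι 𝕜) :
    RCLike.re (A * B).trace ≤ schattenNorm ∞ A * schattenNorm 1 B := by
  obtain ⟨a, b, w, ha, hb, hw, hrow, hcol, htr, -, hB, hA⟩ := exists_re_trace_mul_le A B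
  rw [hB 1 ENNReal.one_ne_top]
  simp only [ENNReal.toReal_one, Real.rpow_one, div_one]
  have hn : 0 ≤ schattenNorm ∞ A := by rw [schattenNorm, if_pos rfl]; positivity
  refine htr.trans ?_
  rw [Finset.sum_comm, Finset.mul_sum]
  refine Finset.sum_le_sum fun j _ => ?_
  calc ∑ i, a i * b j * w i j ≤ ∑ i, schattenNorm ∞ A * b j * w i j :=
        Finset.sum_le_sum fun i _ => mul_le_mul_of_nonneg_right
          (mul_le_mul_of_nonneg_right (hA i) (hb j)) (hw i j)
    _ = schattenNorm ∞ A * b j * ∑ i, w i j := by rw [Finset.mul_sum]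
    _ ≤ _ := mul_le_of_le_one_right (mul_nonneg hn (hb j)) (hcol j)

theorem schattenNorm_conjTranspose {p : ℝ≥0∞} (hp : p ≠ ∞) (A : Matrix ι ι 𝕜) :
    schattenNorm p Aᴴ = schattenNorm p A := by
  obtain ⟨U, V, a, hU, hV, ha, hA⟩ := A.exists_svd
  have hA' : Aᴴ = V * diagonal (fun i => (a i : 𝕜)) * Uᴴ := by
    rw [hA, conjTranspose_mul, conjTranspose_mul, conjTranspose_conjTranspose,
      diagonal_conjTranspose, Matrix.mul_assoc]
    congr 3; funext i; simp
  rw [hA', schattenNorm_svd hV hU ha hp, hA, schattenNorm_svd hU hV ha hp]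

end Holder

/-! ### The inequality for `1 ≤ p ≤ 2` -/

section BlockNorm

open Matrix Polynomial

variable {ι : Type*} [Fintype ι] [DecidableEq ι]

theorem schattenNorm_symm_two {x y z : ℝ} (hx : 0 ≤ x) (hz : 0 ≤ z) (h : y ^ 2 ≤ x * z)
    {p : ℝ≥0∞} (hp : p ≠ ∞) :
    schattenNorm p !![x, y; y, z] = eigPowSum p.toReal x y z ^ (1 / p.toReal) := by
  have hH : (!![x, y; y, z] : Matrix (Fin 2) (Fin 2) ℝ).IsHermitian := by
    ext i j; fin_cases i <;> fin_cases j <;> simp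
  rw [schattenNorm_of_charpoly hH (d := ![eigHi x y z, eigLo x y z]) ?_ ?_ hp]
  · simp [Fin.sum_univ_two, eigPowSum]
  · intro i
    fin_cases i
    exacts [eigHi_nonneg y hx hz, eigLo_nonneg hx hz h]
  · have e1 := eigHi_add_eigLo x y z
    have e2 := eigHi_add_mul_eigLo_add x y z 0
    simp only [add_zero] at e2
    rw [charpoly_fin_two, trace_fin_two_of, det_fin_two_of, Fin.prod_univ_two, ← e1,
      show x * z - y * y = eigHi x y z * eigLo x y z by rw [e2]; ring]
    simp only [RCLike.ofReal_real_eq_id, id, cons_val_zero, cons_val_one, C_add, C_mul]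
    ring

theorem schattenNorm_nonneg {𝕜 : Type*} [RCLike 𝕜] (p : ℝ≥0∞) (A : Matrix ι ι 𝕜) :
    0 ≤ schattenNorm p A := by
  by_cases hp : p = ∞
  · rw [schattenNorm, if_pos hp]; positivity
  · obtain ⟨U, V, a, hU, hV, ha, hA⟩ := A.exists_svd
    rw [hA, schattenNorm_svd hU hV ha hp]
    exact Real.rpow_nonneg (Finset.sum_nonneg fun i _ => Real.rpow_nonneg (ha i) _) _

/-- The block norm inequality for exponents `1 ≤ p ≤ 2`. -/
theorem schattenNorm_blockNormMatrix_le {X Y Z : Matrix ι ι ℂ}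
    (hM : (fromBlocks X Y Yᴴ Z).PosSemidef) {p : ℝ≥0∞} (h1 : 1 ≤ p) (h2 : p ≤ 2) :
    schattenNorm p (blockNormMatrix p X Y Z) ≤ schattenNorm p (fromBlocks X Y Yᴴ Z) := by
  have hp : p ≠ ∞ := ne_top_of_le_ne_top (by simp) h2
  have r1 : 1 ≤ p.toReal := by
    simpa using (ENNReal.toReal_le_toReal ENNReal.one_ne_top hp).2 h1
  have r2 : p.toReal ≤ 2 := by
    simpa using (ENNReal.toReal_le_toReal hp (by simp)).2 h2
  have r0 : 0 < p.toReal := by linarith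
  obtain ⟨U, V, y, hU, hV, hy, hY⟩ := Y.exists_svd
  have hU' := mul_eq_one_comm.1 hU
  have hV' := mul_eq_one_comm.1 hV
  set D : Matrix ι ι ℂ := diagonal fun i => (y i : ℂ) with hD
  have hY' : Y = U * D * Vᴴ := hY
  have hDh : Dᴴ = D := by rw [hD, diagonal_conjTranspose]; congr 1; funext i; simp
  -- Conjugation by `diag (U, V)` makes the off-diagonal blocks diagonal and preserves every norm
  -- involved.
  set W : Matrix (ι ⊕ ι) (ι ⊕ ι) ℂ := fromBlocks U 0 0 V with hW
  have hWW : W * Wᴴ = 1 := by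
    rw [hW, fromBlocks_conjTranspose, fromBlocks_multiply]; simp [hU', hV']
  have e12 : Uᴴ * Y * V = D := by
    calc Uᴴ * Y * V = (Uᴴ * U) * D * (Vᴴ * V) := by rw [hY']; simp only [Matrix.mul_assoc]
      _ = D := by rw [hU, hV, Matrix.one_mul, Matrix.mul_one]
  have e21 : Vᴴ * Yᴴ * U = D := by
    rw [← hDh, ← e12, conjTranspose_mul, conjTranspose_mul, conjTranspose_conjTranspose,
      Matrix.mul_assoc]
  have hconj : Wᴴ * fromBlocks X Y Yᴴ Z * W = fromBlocks (Uᴴ * X * U) D D (Vᴴ * Z * V) := by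
    rw [hW, fromBlocks_conjTranspose, fromBlocks_multiply, fromBlocks_multiply]
    simp [e12, e21]
  have hM' : (fromBlocks (Uᴴ * X * U) D D (Vᴴ * Z * V)).PosSemidef := by
    rw [← hconj]; exact hM.conjTranspose_mul_mul_same W
  have hX : X.PosSemidef := hM.submatrix Sum.inl
  have hZ : Z.PosSemidef := hM.submatrix Sum.inr
  have hX' := hX.conjTranspose_mul_mul_same U
  have hZ' := hZ.conjTranspose_mul_mul_same V
  have cp : ∀ {κ : Type _} [Fintype κ] [DecidableEq κ] {S A : Matrix κ κ ℂ}, S * Sᴴ = 1 →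
      (Sᴴ * A * S).charpoly = A.charpoly := fun {κ} _ _ {S A} hS => by
    rw [charpoly_mul_comm, ← Matrix.mul_assoc, hS, Matrix.one_mul]
  have nM : schattenNorm p (fromBlocks X Y Yᴴ Z)
      = (∑ i, hM'.isHermitian.eigenvalues i ^ p.toReal) ^ (1 / p.toReal) :=
    schattenNorm_of_charpoly hM.isHermitian hM'.eigenvalues_nonneg
      (by rw [← cp hWW, hconj]; exact hM'.isHermitian.charpoly_eq) hp
  have nX : schattenNorm p X
      = (∑ i, hX'.isHermitian.eigenvalues i ^ p.toReal) ^ (1 / p.toReal) :=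
    schattenNorm_of_charpoly hX.isHermitian hX'.eigenvalues_nonneg
      (by rw [← cp hU']; exact hX'.isHermitian.charpoly_eq) hp
  have nZ : schattenNorm p Z
      = (∑ i, hZ'.isHermitian.eigenvalues i ^ p.toReal) ^ (1 / p.toReal) :=
    schattenNorm_of_charpoly hZ.isHermitian hZ'.eigenvalues_nonneg
      (by rw [← cp hV']; exact hZ'.isHermitian.charpoly_eq) hp
  have nY : schattenNorm p Y = (∑ i, y i ^ p.toReal) ^ (1 / p.toReal) := by
    rw [hY, schattenNorm_svd hU hV hy hp]
  have snn : ∀ {κ : Type _} [Fintype κ] {f : κ → ℝ}, (∀ i, 0 ≤ f i) → 0 ≤ ∑ i, f i ^ p.toReal :=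
    fun hf => Finset.sum_nonneg fun i _ => Real.rpow_nonneg (hf i) _
  have pw : ∀ {a s : ℝ}, 0 ≤ s → a = s ^ (1 / p.toReal) → a ^ p.toReal = s := fun hs ha => by
    rw [ha, one_div, Real.rpow_inv_rpow hs r0.ne']
  have pX := pw (snn hX'.eigenvalues_nonneg) nX
  have pZ := pw (snn hZ'.eigenvalues_nonneg) nZ
  have hx : ∀ i, 0 ≤ ((Uᴴ * X * U) i i).re := fun i => (Complex.nonneg_iff.1 hX'.diag_nonneg).1
  have hz : ∀ i, 0 ≤ ((Vᴴ * Z * V) i i).re := fun i => (Complex.nonneg_iff.1 hZ'.diag_nonneg).1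
  have hxyz : ∀ i, y i ^ 2 ≤ ((Uᴴ * X * U) i i).re * ((Vᴴ * Z * V) i i).re := fun i => by
    -- The principal minor on the `i`-th index pair.
    have := (hM'.submatrix ![Sum.inl i, Sum.inr i]).det_nonneg
    rw [det_fin_two] at this
    have hi := (Complex.nonneg_iff.1 (hX'.diag_nonneg (i := i))).2
    have := (Complex.nonneg_iff.1 this).1
    simp only [submatrix_apply, cons_val_zero, cons_val_one, fromBlocks_apply₁₁,
      fromBlocks_apply₁₂, fromBlocks_apply₂₁, fromBlocks_apply₂₂, hD, diagonal_apply_eq,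
      Complex.sub_re, Complex.mul_re, ← hi, Complex.ofReal_re, Complex.ofReal_im] at this
    nlinarith
  have dX := hX'.sum_rpow_diag_le r1
  have dZ := hZ'.sum_rpow_diag_le r1
  have hsq : schattenNorm p Y ^ 2 ≤ schattenNorm p X * schattenNorm p Z := by
    rw [nX, nY, nZ]
    refine (sq_lp_le_mul_lp r0 Finset.univ hx hz hy hxyz).trans ?_
    exact mul_le_mul (Real.rpow_le_rpow (snn hx) dX (by positivity))
      (Real.rpow_le_rpow (snn hz) dZ (by positivity)) (Real.rpow_nonneg (snn hz) _)
      (Real.rpow_nonneg (snn hX'.eigenvalues_nonneg) _)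
  -- `main` bounds the excess of `M` below by the `2 × 2` excesses, `sc` bounds their sum below by
  -- the excess of `m`. The terms `‖X‖_p^p` and `‖Z‖_p^p` are common to both ends and cancel.
  have main := sum_rpow_eigenvalues_block_le hM' hX' hZ' hxyz r1 r2
  have sc := eigPowSum_sub_le_sum r1 r2 hx hz hy hxyz (schattenNorm_nonneg p X)
    (schattenNorm_nonneg p Z) (by rw [pX]; exact dX) (by rw [pZ]; exact dZ)
  rw [← nY, pX, pZ] at sc
  simp only [Finset.sum_sub_distrib] at sc
  rw [blockNormMatrix, schattenNorm_symm_two (schattenNorm_nonneg p X) (schattenNorm_nonneg p Z)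
    hsq hp, nM]
  refine Real.rpow_le_rpow (eigPowSum_nonneg _ (schattenNorm_nonneg p X)
    (schattenNorm_nonneg p Z) hsq) ?_ (by positivity)
  linarith

end BlockNorm

/-! ### Duality and the inequality for `p ≥ 2` -/

section Duality

open Matrix

variable {ι : Type*} [Fintype ι] [DecidableEq ι]

/-- Blockwise Hölder bounds the trace by that of a product of two `2 × 2` norm matrices; Hölder
again and the case `q ≤ 2` applied to `N` finish. Hölder enters as hypotheses so that finite `p` and
`p = ∞` share the argument. -/
theorem re_trace_mul_le_blockNormMatrix_mul {X Y Z : Matrix ι ι ℂ}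
    {N : Matrix (ι ⊕ ι) (ι ⊕ ι) ℂ} (hN : N.PosSemidef) {p q : ℝ≥0∞} (h1 : 1 ≤ q) (h2 : q ≤ 2)
    (hC : ∀ A B : Matrix ι ι ℂ, (A * B).trace.re ≤ schattenNorm p A * schattenNorm q B)
    (hR : ∀ A B : Matrix (Fin 2) (Fin 2) ℝ,
      (A * B).trace ≤ schattenNorm p A * schattenNorm q B) :
    (fromBlocks X Y Yᴴ Z * N).trace.re
      ≤ schattenNorm p (blockNormMatrix p X Y Z) * schattenNorm q N := by
  have hq : q ≠ ∞ := ne_top_of_le_ne_top (by simp) h2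
  obtain ⟨A, B, C, D, rfl⟩ : ∃ A B C D, N = fromBlocks A B C D :=
    ⟨_, _, _, _, (fromBlocks_toBlocks N).symm⟩
  obtain rfl : C = Bᴴ := by
    have := hN.isHermitian
    rw [isHermitian_fromBlocks_iff] at this
    exact this.2.1.symm
  have e1 : (Yᴴ * B).trace.re = (Y * Bᴴ).trace.re := by
    have : (Yᴴ * B).trace = star (Y * Bᴴ).trace := by
      rw [← trace_conjTranspose, conjTranspose_mul, conjTranspose_conjTranspose, trace_mul_comm]
    rw [this]; simp
  have e2 : (fromBlocks X Y Yᴴ Z * fromBlocks A B Bᴴ D).trace.re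
      = (X * A).trace.re + (Y * Bᴴ).trace.re + ((Y * Bᴴ).trace.re + (Z * D).trace.re) := by
    have h (P Q R S : Matrix ι ι ℂ) : (fromBlocks P Q R S).trace = P.trace + S.trace := by
      simp [trace, Fintype.sum_sum_type]
    rw [fromBlocks_multiply, h, trace_add, trace_add, Complex.add_re,
      Complex.add_re, Complex.add_re, e1]
  have e3 : (blockNormMatrix p X Y Z * blockNormMatrix q A B D).trace
      = schattenNorm p X * schattenNorm q A + schattenNorm p Y * schattenNorm q B
        + (schattenNorm p Y * schattenNorm q B + schattenNorm p Z * schattenNorm q D) := by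
    rw [blockNormMatrix, blockNormMatrix, mul_fin_two, trace_fin_two_of]
  have hB := hC Y Bᴴ
  rw [schattenNorm_conjTranspose hq] at hB
  rw [e2]
  calc _ ≤ (blockNormMatrix p X Y Z * blockNormMatrix q A B D).trace := by
        rw [e3]; linarith [hC X A, hC Z D]
    _ ≤ _ := hR _ _
    _ ≤ _ := mul_le_mul_of_nonneg_left (schattenNorm_blockNormMatrix_le hN h1 h2)
        (schattenNorm_nonneg _ _)

theorem trace_unitary_diagonal_mul {κ : Type*} [Fintype κ] [DecidableEq κ] {U : Matrix κ κ ℂ}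
    (hU : Uᴴ * U = 1) (a b : κ → ℝ) :
    (U * diagonal (fun i => (a i : ℂ)) * Uᴴ * (U * diagonal (fun i => (b i : ℂ)) * Uᴴ)).trace.re
      = ∑ i, a i * b i := by
  have : U * diagonal (fun i => (a i : ℂ)) * Uᴴ * (U * diagonal (fun i => (b i : ℂ)) * Uᴴ)
      = U * (diagonal (fun i => (a i : ℂ)) * diagonal (fun i => (b i : ℂ)) * Uᴴ) := by
    calc _ = U * (diagonal (fun i => (a i : ℂ)) * (Uᴴ * U) * diagonal (fun i => (b i : ℂ)) * Uᴴ) := by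
          simp only [Matrix.mul_assoc]
      _ = _ := by rw [hU, Matrix.mul_one]
  rw [this, trace_mul_comm, Matrix.mul_assoc, hU, Matrix.mul_one, diagonal_mul_diagonal,
    trace_diagonal]
  simp

theorem posSemidef_unitary_diagonal {κ : Type*} [Fintype κ] [DecidableEq κ] (U : Matrix κ κ ℂ)
    {b : κ → ℝ} (hb : ∀ i, 0 ≤ b i) :
    (U * diagonal (fun i => (b i : ℂ)) * Uᴴ).PosSemidef :=
  (PosSemidef.diagonal fun i => by
    simpa using hb i).mul_mul_conjTranspose_same U

/-- The block norm inequality for exponents `2 ≤ p < ∞`. -/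
theorem schattenNorm_le_blockNormMatrix_of_ne_top {X Y Z : Matrix ι ι ℂ}
    (hM : (fromBlocks X Y Yᴴ Z).PosSemidef) {p : ℝ≥0∞} (h2 : 2 ≤ p) (hp : p ≠ ∞) :
    schattenNorm p (fromBlocks X Y Yᴴ Z) ≤ schattenNorm p (blockNormMatrix p X Y Z) := by
  have r2 : 2 ≤ p.toReal := by
    simpa using (ENNReal.toReal_le_toReal (by simp) hp).2 h2
  obtain ⟨r, hr, rfl⟩ : ∃ r : ℝ, 2 ≤ r ∧ p = ENNReal.ofReal r :=
    ⟨p.toReal, r2, (ENNReal.ofReal_toReal hp).symm⟩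
  have hr1 : 1 < r := by linarith
  have hr0 : 0 < r := by linarith
  have hr' : 0 < r - 1 := by linarith
  have hconj : r.HolderConjugate (r / (r - 1)) := Real.HolderConjugate.conjExponent hr1
  have ht1 : 1 ≤ r / (r - 1) := by rw [one_le_div hr']; linarith
  have ht2 : r / (r - 1) ≤ 2 := by rw [div_le_iff₀ hr']; linarith
  have ht0 : 0 < r / (r - 1) := by positivity
  obtain ⟨U, hU1, hU2, hU⟩ := hM.isHermitian.exists_unitary_diagonal
  have hnn := hM.eigenvalues_nonneg
  generalize hM.isHermitian.eigenvalues = e at hU hnn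
  have hpow : ∀ i, 0 ≤ e i ^ (r - 1) := fun i => Real.rpow_nonneg (hnn i) _
  have hpr : (ENNReal.ofReal r).toReal = r := ENNReal.toReal_ofReal hr0.le
  have hqr : (ENNReal.ofReal (r / (r - 1))).toReal = r / (r - 1) := ENNReal.toReal_ofReal ht0.le
  -- The test matrix is `N = M^(r-1)`, the equality case of Hölder: `Tr (MN)` and `‖N‖_q^q` both
  -- equal `S = ∑ e i ^ r`, and dividing by `S^(1/q)` leaves `‖M‖_r`.
  have key := re_trace_mul_le_blockNormMatrix_mul (X := X) (Y := Y) (Z := Z)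
    (p := ENNReal.ofReal r) (q := ENNReal.ofReal (r / (r - 1)))
    (posSemidef_unitary_diagonal U hpow) (by simpa using ht1)
    (by simpa using ENNReal.ofReal_le_ofReal ht2)
    (fun A B => re_trace_mul_le_schattenNorm_mul A B hp ENNReal.ofReal_ne_top
      (by rw [hpr, hqr]; exact hconj))
    (fun A B => re_trace_mul_le_schattenNorm_mul A B hp ENNReal.ofReal_ne_top
      (by rw [hpr, hqr]; exact hconj))
  have hN := schattenNorm_svd hU1 hU1 hpow
    (p := ENNReal.ofReal (r / (r - 1))) ENNReal.ofReal_ne_top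
  have hMn := schattenNorm_svd hU1 hU1 hnn hp
  have hU : fromBlocks X Y Yᴴ Z = U * diagonal (fun i => (e i : ℂ)) * Uᴴ := hU
  simp only [RCLike.ofReal_eq_complex_ofReal] at hN hMn
  rw [hU] at key ⊢
  rw [hN, trace_unitary_diagonal_mul hU1, hqr] at key
  rw [hMn, hpr]
  have s1 : ∀ i, e i * e i ^ (r - 1) = e i ^ r := fun i => by
    conv_lhs => rw [← Real.rpow_one (e i)]
    rw [Real.rpow_one, ← Real.rpow_one_add' (hnn i) (by linarith)]
    congr 1; ring
  have s2 : ∀ i, (e i ^ (r - 1)) ^ (r / (r - 1)) = e i ^ r := fun i => by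
    rw [← Real.rpow_mul (hnn i)]
    congr 1; field_simp
  simp only [s1, s2] at key
  have hS : 0 ≤ ∑ i, e i ^ r := Finset.sum_nonneg fun i _ => Real.rpow_nonneg (hnn i) _
  generalize ∑ i, e i ^ r = S at key hS
  rcases hS.eq_or_lt with rfl | hS
  · rw [Real.zero_rpow (by positivity)]; exact schattenNorm_nonneg _ _
  · refine le_of_mul_le_mul_right ?_ (Real.rpow_pos_of_pos hS (1 / (r / (r - 1))))
    rw [← Real.rpow_add hS]
    have : 1 / r + 1 / (r / (r - 1)) = 1 := by field_simp; ring
    rwa [this, Real.rpow_one]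

/-- The block norm inequality for the operator norm. -/
theorem schattenNorm_top_le_blockNormMatrix {X Y Z : Matrix ι ι ℂ}
    (hM : (fromBlocks X Y Yᴴ Z).PosSemidef) :
    schattenNorm ∞ (fromBlocks X Y Yᴴ Z) ≤ schattenNorm ∞ (blockNormMatrix ∞ X Y Z) := by
  obtain ⟨U, hU1, hU2, hU⟩ := hM.isHermitian.exists_unitary_diagonal
  have hnn := hM.eigenvalues_nonneg
  generalize hM.isHermitian.eigenvalues = e at hU hnn
  have hMn := schattenNorm_top_svd hU1 hU1 e
  have hU : fromBlocks X Y Yᴴ Z = U * diagonal (fun i => (e i : ℂ)) * Uᴴ := hU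
  simp only [RCLike.ofReal_eq_complex_ofReal] at hMn
  rw [hU, hMn, pi_norm_le_iff_of_nonneg (schattenNorm_nonneg _ _)]
  intro k
  have hδ : ∀ i, 0 ≤ (Pi.single k 1 : ι ⊕ ι → ℝ) i := fun i => by
    by_cases h : i = k
    · subst h; simp
    · simp [h]
  -- The test matrix is the projection onto the `k`-th eigenvector, of trace norm `1`, so the
  -- pairing returns the eigenvalue `e k`.
  have key := re_trace_mul_le_blockNormMatrix_mul (X := X) (Y := Y) (Z := Z) (p := ∞) (q := 1)
    (posSemidef_unitary_diagonal U hδ) le_rfl (by norm_num)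
    (fun A B => re_trace_mul_le_schattenNorm_top_mul A B)
    (fun A B => re_trace_mul_le_schattenNorm_top_mul A B)
  have hN := schattenNorm_svd hU1 hU1 hδ (p := 1) ENNReal.one_ne_top
  simp only [RCLike.ofReal_eq_complex_ofReal] at hN
  rw [hU, hN, trace_unitary_diagonal_mul hU1] at key
  simp only [ENNReal.toReal_one, Real.rpow_one, div_one] at key
  rw [Complex.norm_real, Real.norm_of_nonneg (hnn k)]
  simpa [Pi.single_apply] using key

end Duality

theorem theorem1 (n : ℕ) (X Y Z : Matrix (Fin n) (Fin n) ℂ)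
    (hM : (Matrix.fromBlocks X Y Yᴴ Z).PosSemidef) (p : ℝ≥0∞) :
    (1 ≤ p → p ≤ 2 →
      schattenNorm p (blockNormMatrix p X Y Z) ≤ schattenNorm p (Matrix.fromBlocks X Y Yᴴ Z)) ∧
    (2 ≤ p →
      schattenNorm p (Matrix.fromBlocks X Y Yᴴ Z) ≤ schattenNorm p (blockNormMatrix p X Y Z)) := by
  refine ⟨fun h1 h2 => schattenNorm_blockNormMatrix_le hM h1 h2, fun h2 => ?_⟩
  by_cases hp : p = ∞
  · subst hp; exact schattenNorm_top_le_blockNormMatrix hM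
  · exact schattenNorm_le_blockNormMatrix_of_ne_top hM h2 hp
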